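/- **Setting.** Let $n,p\ge 1$ and let $\mathcal G$ be a strongly connected directed graph on the agents $\{1,\dots,n\}$. Let $C\in\mathbb R^{n\times n}$ be supported by $\mathcal G$ ($C_{ij}\neq 0$ only if $(i,j)$ is an edge), column stochastic (nonnegative entries, $\mathbf 1^\top C=\mathbf 1^\top$) and regular (some power $C^\ell$, $\ell\ge0$, has only positive entries). Let $L,\mu>0$ and let $f_1,\dots,f_n:\mathbb R^p\to\mathbb R$ be differentiable, convex and $L$-smooth, $$f_i(x)+\langle\nabla f_i(x),y-x\rangle\le f_i(y)\le f_i(x)+\langle\nabla f_i(x),y-x\rangle+\tfrac L2\|x-y\|^2 ,$$ and $\mu$-strongly convex, $\langle x-y,\nabla f_i(x)-\nabla f_i(y)\rangle\ge\mu\|x-y\|^2$, for all $x,y$. Let $f=\frac1n\sum_i f_i$ and let $x^*$ be a minimizer of $f$. Let $X_0\in\mathbb R^{n\times p}$, and $v_0\in\mathbb R^n$ with positive entries and $\mathbf 1^\top v_0=n$. **Algorithm.** Given $\alpha,\beta,\tau,\eta$, put $Y_0=Z_0=X_0$, $V_k=\mathrm{Diag}(v_k)$, $G_0=\nabla F(V_0^{-1}X_0)$,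 where row $i$ of $\nabla F(U)$ is $\nabla f_i(u_i)^\top$ ($u_i^\top$ being row $i$ of $U$), and for $k\ge0$ $$v_{k+1}=Cv_k,\quad Y_{k+1}=C(X_k-\eta G_k),\quad Z_{k+1}=C\big((1-\beta)Z_k+\beta X_k-\alpha\eta G_k\big),$$ $$X_{k+1}=(1-\tau)Y_{k+1}+\tau Z_{k+1},\quad G_{k+1}=CG_k+\nabla F(V_{k+1}^{-1}X_{k+1})-\nabla F(V_k^{-1}X_k).$$ The output after $K$ iterations is $V_K^{-1}Y_K$, with rows $v_{K,i}^{-1}y_{K,i}$. **Constants.** (i) There is exactly one positive vector $\pi$ with $C\pi=\pi$, $\mathbf 1^\top\pi=n$. Put $\Pi=I-\frac{\pi\mathbf 1^\top}n$. (ii) Put $\kappa=1/\inf_{k,i}v_{k,i}$; then $\kappa\ge1$ and $v_{k,i}^{-1}\le\kappa$ for all $k,i$. (iii) The spectral radius satisfies $\rho\big(C-\frac{\pi\mathbf 1^\top}n\big)<1$. (iv) Let $0<\vartheta<1-\rho\big(C-\frac{\pi\mathbf 1^\top}n\big)$. Then there are an invertible $S\in\mathbb R^{n\times n}$ and $\delta\ge1$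 such that the norm $\|x\|_C=\|Sx\|$ and its induced operator norm satisfy $$\|x\|_C\le\|x\|\le\delta\|x\|_C\ (x\in\mathbb R^n),\qquad \Big\|C-\tfrac{\pi\mathbf 1^\top}n\Big\|_C\le1-\vartheta,\qquad \|\Pi\|_C\le1 .$$ Fix any such $S,\delta$. For an $n\times p$ matrix $A$ with columns $A_{:,c}$ put $\|A\|_C=\big(\sum_c\|A_{:,c}\|_C^2\big)^{1/2}$. Put $w=\|v_0-\pi\|_C$, $\bar x_0=\frac1n X_0^\top\mathbf 1$, and $$\pi_3=\tfrac87\Big(\tfrac{3\vartheta}2+6\alpha^2\tau^2\vartheta+\tfrac{48\alpha^2\tau^2}7\Big),\qquad \Phi^{(3)}_0=\|\bar x_0\|^2+\tfrac8{\vartheta^2}\tau^2\|\bar x_0\|^2,$$ $$\Phi^{(4)}_0=\Big(1+\tfrac{24}{7\vartheta^2}\Big)\|\Pi X_0\|_C^2+\tfrac{\pi_3\eta^2}{\vartheta^4}\|\Pi G_0\|_C^2 .$$ **Theorem.** Suppose $\alpha\tau=\frac1{12}$, $\tau\in(0,1)$, $$0<\eta\le\min\Big\{\tfrac{\alpha\tau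 n\vartheta^4}{2160\,\delta^2\kappa^2(1+\alpha\tau)^2w^2L},\ \tfrac{\sqrt{\alpha\tau}\,\vartheta^3}{8\sqrt{5\pi_3(15+9\alpha\tau)}\,\delta\kappa L},\ \tfrac1{24\alpha\tau L},\ \tfrac{\vartheta^3}{8\sqrt{5\pi_3(18+3\alpha\tau)}\,\delta\kappa L},\ \tfrac{\vartheta^3}{8\sqrt{15\pi_3}\,\delta\kappa L}\Big\}$$ (the first bound being void if $w=0$) and $0<\beta\le\min\big\{\tau,\frac\vartheta{16},\frac{\vartheta^2}{8\tau},\frac{\mu\alpha\eta}2\big\}$. Then for every integer $K\ge0$ $$\frac1n\sum_{i=1}^nf\big(v_{K,i}^{-1}y_{K,i}\big)-f(x^*)\le(1-\beta)^{K-2}\Big(\tfrac7{12}+\tfrac{3\delta^2\kappa^2(1-\vartheta)^{2K}w^2\eta L}n\Big)$$ $$\cdot\Big(18(1-\beta)(1-\tau)\big(f(\bar x_0)-f(x^*)\big)+\tfrac{960\,\delta^2\kappa^2L}{n\vartheta}\Phi^{(4)}_0+\tfrac{180\,\delta^2\kappa^2Lw^2}{n\vartheta}\Phi^{(3)}_0+\tfrac{1-\beta}{2\alpha^2\eta}\|\bar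 x_0-x^*\|^2\Big),$$ and $\Phi^{(3)}_0\le\big(1+\frac8{\vartheta^2}\big)\sum_i\|x_{0,i}\|^2$, where $x_{0,i}^\top$ are the rows of $X_0$. **Linear rate.** Put $D=\delta\kappa\big(1+\frac{\delta\kappa w^2}\vartheta\big)$. For every $0<c\le\frac1{40000}$ the choice $\eta=\frac{c\,\vartheta^3}{LD}$, $\tau=\sqrt{\mu\eta}$, $\alpha=\frac1{12\sqrt{\mu\eta}}$, $\beta=\frac{\sqrt{\mu\eta}}{24}$ satisfies all these conditions, and with $C_0=\frac{\sqrt c}{24}\vartheta^{3/2}D^{-1/2}$ (independent of $L$, $\mu$ and the $f_i$) one has $0<C_0\sqrt{\mu/L}<1$ and, as $K\to\infty$, $$\frac1n\sum_{i=1}^nf\big(v_{K,i}^{-1}y_{K,i}\big)-f(x^*)=O\Big(\big(1-C_0\sqrt{\mu/L}\big)^K\Big).$$ -/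

import Mathlib

open scoped BigOperators

noncomputable section

namespace PushDIGing

/-- The space `ℝ^p` with its Euclidean norm. -/
abbrev Vec (p : ℕ) : Type := EuclideanSpace ℝ (Fin p)

/-- An `n × p` matrix, given by its rows: row `i` is the local variable of agent `i`. -/
abbrev Stack (n p : ℕ) : Type := Fin n → Vec p

/-! ### Objective functions -/

/-- `g` is differentiable, convex and `L`-smooth. -/
structure IsConvexSmooth {p : ℕ} (L : ℝ) (g : Vec p → ℝ) : Prop where
  differentiable : Differentiable ℝ g
  lower : ∀ x y, g x + inner ℝ (gradient g x) (y - x) ≤ g y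
  upper : ∀ x y, g y ≤ g x + inner ℝ (gradient g x) (y - x) + L / 2 * ‖x - y‖ ^ 2

/-- `g` is `μ`-strongly convex (strong monotonicity of the gradient). -/
def IsStronglyConvex {p : ℕ} (μ : ℝ) (g : Vec p → ℝ) : Prop :=
  ∀ x y, μ * ‖x - y‖ ^ 2 ≤ inner ℝ (x - y) (gradient g x - gradient g y)

/-- The global objective `f = (1/n) ∑ f_i`. -/
def objective {n p : ℕ} (f : Fin n → Vec p → ℝ) (x : Vec p) : ℝ :=
  (1 / (n : ℝ)) * ∑ i, f i x

/-! ### Network and mixing matrix -/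

/-- Every vertex is reachable from every vertex along directed edges. -/
def StronglyConnected {n : ℕ} (𝒢 : Digraph (Fin n)) : Prop :=
  ∀ i j, Relation.ReflTransGen 𝒢.Adj i j

/-- `C` is supported by `𝒢`, column stochastic and regular. -/
structure IsMixingMatrix {n : ℕ} (𝒢 : Digraph (Fin n)) (C : Matrix (Fin n) (Fin n) ℝ) :
    Prop where
  support : ∀ i j, C i j ≠ 0 → 𝒢.Adj i j
  nonneg : ∀ i j, 0 ≤ C i j
  col_sum : ∀ j, ∑ i, C i j = 1
  regular : ∃ l : ℕ, ∀ i j, 0 < (C ^ l) i j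

/-- `q` is a positive right eigenvector of `C` for the eigenvalue `1` with `1ᵀ q = n`. -/
structure IsPerronVector {n : ℕ} (C : Matrix (Fin n) (Fin n) ℝ) (q : Fin n → ℝ) : Prop where
  pos : ∀ i, 0 < q i
  eigen : C.mulVec q = q
  sum_eq : ∑ i, q i = n

/-- The rank-one matrix `q 1ᵀ / n`. -/
def rankOne {n : ℕ} (q : Fin n → ℝ) : Matrix (Fin n) (Fin n) ℝ :=
  Matrix.of fun i _ => q i / (n : ℝ)

/-- The spectral radius of a real square matrix: the largest modulus of its complex
eigenvalues. -/
def rho {n : ℕ} (A : Matrix (Fin n) (Fin n) ℝ) : ℝ :=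
  (spectralRadius ℂ (A.map (algebraMap ℝ ℂ))).toReal

/-- The vector norm `‖x‖_C = ‖S x‖` induced by a square matrix `S`. -/
def vecNorm {n : ℕ} (S : Matrix (Fin n) (Fin n) ℝ) (x : Fin n → ℝ) : ℝ :=
  ‖(WithLp.toLp 2 (S.mulVec x) : EuclideanSpace ℝ (Fin n))‖

/-- The norm of an `n × p` matrix that goes with `vecNorm S`: the Euclidean norm of the vector
of the norms of the columns. -/
def matNorm {n p : ℕ} (S : Matrix (Fin n) (Fin n) ℝ) (A : Stack n p) : ℝ :=
  Real.sqrt (∑ c : Fin p, vecNorm S (fun i => A i c) ^ 2)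

/-- The product of an `n × n` matrix with an `n × p` matrix. -/
def mix {n p : ℕ} (A : Matrix (Fin n) (Fin n) ℝ) (X : Stack n p) : Stack n p :=
  fun i => ∑ j, A i j • X j

/-- The average of the rows, `(1/n) 1ᵀ X`. -/
def rowMean {n p : ℕ} (X : Stack n p) : Vec p := (1 / (n : ℝ)) • ∑ i, X i

/-- The consensus error `(I - q 1ᵀ / n) X`. -/
def consensusError {n p : ℕ} (q : Fin n → ℝ) (X : Stack n p) : Stack n p :=
  mix (1 - rankOne q) X

/-- The norm `‖x‖_C = ‖S x‖`, with `S` invertible, satisfies `‖x‖_C ≤ ‖x‖ ≤ δ ‖x‖_C`, and the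
operator norms it induces satisfy `‖C - q 1ᵀ / n‖_C ≤ 1 - ϑ` and `‖I - q 1ᵀ / n‖_C ≤ 1`.
(The matrix `I - q 1ᵀ / n` is a projection, nonzero for `n ≥ 2`, so that the last norm is then
equal to `1`; for `n = 1` the matrix is zero.) -/
structure IsMixingNorm {n : ℕ} (C : Matrix (Fin n) (Fin n) ℝ) (q : Fin n → ℝ) (ϑ : ℝ)
    (S : Matrix (Fin n) (Fin n) ℝ) (δ : ℝ) : Prop where
  invertible : IsUnit S
  one_le : 1 ≤ δ
  le_euclidean : ∀ x, vecNorm S x ≤ ‖(WithLp.toLp 2 x : EuclideanSpace ℝ (Fin n))‖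
  euclidean_le : ∀ x, ‖(WithLp.toLp 2 x : EuclideanSpace ℝ (Fin n))‖ ≤ δ * vecNorm S x
  contraction : ∀ x, vecNorm S ((C - rankOne q).mulVec x) ≤ (1 - ϑ) * vecNorm S x
  projection : ∀ x, vecNorm S ((1 - rankOne q).mulVec x) ≤ vecNorm S x

/-! ### The accelerated Push-DIGing method for strongly convex objectives -/

/-- The weights `v_{k+1} = C v_k`. -/
def weights {n : ℕ} (C : Matrix (Fin n) (Fin n) ℝ) (v₀ : Fin n → ℝ) : ℕ → Fin n → ℝ
  | 0 => v₀
  | k + 1 => C.mulVec (weights C v₀ k)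

/-- `κ = 1 / inf_{k, i} v_{k,i}`, the uniform bound on the norms of `V_k⁻¹ = Diag(v_k)⁻¹`. -/
def kappa {n : ℕ} (C : Matrix (Fin n) (Fin n) ℝ) (v₀ : Fin n → ℝ) : ℝ :=
  (⨅ s : ℕ × Fin n, weights C v₀ s.1 s.2)⁻¹

/-- The stacked gradients `∇F(V⁻¹ X)`, with rows `∇f_i(v_i⁻¹ x_i)`. -/
def stackedGradient {n p : ℕ} (f : Fin n → Vec p → ℝ) (v : Fin n → ℝ) (X : Stack n p) :
    Stack n p :=
  fun i => gradient (f i) ((v i)⁻¹ • X i)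

/-- The stacked variables of one iteration. -/
structure State (n p : ℕ) where
  X : Stack n p
  Y : Stack n p
  Z : Stack n p
  G : Stack n p

/-- The iterates `(X_k, Y_k, Z_k, G_k)` of the method. -/
def iterates {n p : ℕ} (C : Matrix (Fin n) (Fin n) ℝ) (f : Fin n → Vec p → ℝ)
    (α β τ η : ℝ) (v₀ : Fin n → ℝ) (X₀ : Stack n p) : ℕ → State n p
  | 0 => ⟨X₀, X₀, X₀, stackedGradient f v₀ X₀⟩
  | k + 1 =>
    let s := iterates C f α β τ η v₀ X₀ k
    let Y := mix C (s.X - η • s.G)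
    let Z := mix C ((1 - β) • s.Z + β • s.X - (α * η) • s.G)
    let X := (1 - τ) • Y + τ • Z
    let G := mix C s.G + stackedGradient f (weights C v₀ (k + 1)) X
      - stackedGradient f (weights C v₀ k) s.X
    ⟨X, Y, Z, G⟩

/-- The averaged optimality gap `(1/n) ∑_i f(v_{K,i}⁻¹ y_{K,i}) - f(x*)` of the output
`V_K⁻¹ Y_K`. -/
def outputGap {n p : ℕ} (C : Matrix (Fin n) (Fin n) ℝ) (f : Fin n → Vec p → ℝ)
    (α β τ η : ℝ) (v₀ : Fin n → ℝ) (X₀ : Stack n p) (xs : Vec p) (K : ℕ) : ℝ :=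
  (1 / (n : ℝ)) * ∑ i, objective f
      ((weights C v₀ K i)⁻¹ • (iterates C f α β τ η v₀ X₀ K).Y i)
    - objective f xs

/-! ### Constants and conditions on the parameters -/

/-- The constant `π₃`, as a function of `ϑ` and `a = ατ`. -/
def piThree (ϑ a : ℝ) : ℝ := 8 / 7 * (3 * ϑ / 2 + 6 * a ^ 2 * ϑ + 48 * a ^ 2 / 7)

/-- The conditions on `α, β, τ, η`; here `w = ‖v₀ - q‖_C`. The bound `eta_le₁` is
`η ≤ ατ n ϑ⁴ / (2160 δ² κ² (1 + ατ)² w² L)`, cleared of its denominator because `w` may be zero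
(in which case it is no restriction). -/
structure Admissible (n : ℕ) (L μ ϑ δ κ w α β τ η : ℝ) : Prop where
  alpha_mul_tau : α * τ = 1 / 12
  tau_pos : 0 < τ
  tau_lt_one : τ < 1
  eta_pos : 0 < η
  eta_le₁ : η * (2160 * δ ^ 2 * κ ^ 2 * (1 + α * τ) ^ 2 * w ^ 2 * L) ≤ α * τ * n * ϑ ^ 4
  eta_le₂ : η ≤ Real.sqrt (α * τ) * ϑ ^ 3 /
    (8 * Real.sqrt (5 * piThree ϑ (α * τ) * (15 + 9 * (α * τ))) * δ * κ * L)
  eta_le₃ : η ≤ 1 / (24 * (α * τ) * L)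
  eta_le₄ : η ≤ ϑ ^ 3 /
    (8 * Real.sqrt (5 * piThree ϑ (α * τ) * (18 + 3 * (α * τ))) * δ * κ * L)
  eta_le₅ : η ≤ ϑ ^ 3 / (8 * Real.sqrt (15 * piThree ϑ (α * τ)) * δ * κ * L)
  beta_pos : 0 < β
  beta_le₁ : β ≤ τ
  beta_le₂ : β ≤ ϑ / 16
  beta_le₃ : β ≤ ϑ ^ 2 / (8 * τ)
  beta_le₄ : β ≤ μ * α * η / 2

/-- The initial value `Φ⁽³⁾_0` of the first Lyapunov function. -/
def phiThree {n p : ℕ} (ϑ τ : ℝ) (X₀ : Stack n p) : ℝ :=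
  ‖rowMean X₀‖ ^ 2 + 8 / ϑ ^ 2 * τ ^ 2 * ‖rowMean X₀‖ ^ 2

/-- The initial value `Φ⁽⁴⁾_0` of the second Lyapunov function; `G₀ = ∇F(V₀⁻¹ X₀)`. -/
def phiFour {n p : ℕ} (q : Fin n → ℝ) (S : Matrix (Fin n) (Fin n) ℝ) (ϑ a η : ℝ)
    (X₀ G₀ : Stack n p) : ℝ :=
  (1 + 24 / (7 * ϑ ^ 2)) * matNorm S (consensusError q X₀) ^ 2
    + piThree ϑ a * η ^ 2 / ϑ ^ 4 * matNorm S (consensusError q G₀) ^ 2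

/-- `δκ (1 + δκ w² / ϑ)`, the network factor in the choice of the stepsize. -/
def networkFactor (ϑ δ κ w : ℝ) : ℝ := δ * κ * (1 + δ * κ * w ^ 2 / ϑ)

/-- The stepsize `η = c ϑ³ / (δκ L (1 + δκ w² / ϑ))`. -/
def etaChoice (c L ϑ δ κ w : ℝ) : ℝ := c * ϑ ^ 3 / (L * networkFactor ϑ δ κ w)

/-- The factor of `√(μ/L)` in the linear rate; it depends only on the mixing matrix (with its
norm), on `v₀` and on the numerical constant `c`. -/
def rateConst (c ϑ δ κ w : ℝ) : ℝ :=
  Real.sqrt c / 24 * ϑ ^ (3 / 2 : ℝ) * networkFactor ϑ δ κ w ^ (-(1 / 2) : ℝ)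

end PushDIGing

end

noncomputable section

namespace PushDIGing

/-! ### Inequalities for smooth and strongly convex functions. -/

section Convexity

variable {p : ℕ} {L μ : ℝ} {g : Vec p → ℝ}

/-! Because the columns of `C` sum to one, the row means of `X, Y, Z` run an accelerated gradient
method for `f` whose gradient is replaced by the mean of the local gradients at the points `v_i⁻¹
x_i`. `accelerated_step` analyses one step of it. The error of the inexact gradient is kept as exact
Bregman divergences (`objective_sub_eq`). Strong convexity and cocoercivity of each `f_i` then
leave, besides the contraction by `1 - β`, two surpluses: a multiple of `η ‖g‖²` and a multiple of
the mean squared gradient differences `gradDispersion`. The price is `L` times the dispersion of the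
local points around their mean.

This dispersion has two sources: the consensus error of `X`, and the distance of the weights from
the Perron vector multiplied by the mean of `X`, for which no a priori bound is available. In the
mixing norm, the squared consensus errors of `X`, of the momentum and of the trackers `G` contract
by `1 - ϑ` up to perturbations. The means, damped by the decay `(1 - ϑ) ^ k` of the weight error,
obey recursions of the same shape and are carried along as two more errors.

The perturbations form a chain: gradient differences feed the trackers, trackers feed the momentum
and `X`, and the momentum feeds `X`. `lyapunov` adds these errors with weights for which the
contraction of each pays for what it feeds; the two surpluses pay for the remaining inputs. A
multiple of the gradient differences is subtracted, since those at the new point enter the tracker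
recursion now but are paid for only by the next accelerated step. The sum contracts by `1 - β`
(`energy_succ_le`) and controls the next output (`outputGap_succ_le`).

The constants exist because a positive power of `C` strictly contracts zero-sum vectors in `ℓ¹`,
which gives uniqueness of the Perron vector and the spectral gap; the mixing norm is then built from
Gelfand's formula. -/

theorem IsConvexSmooth.cocoercive (hg : IsConvexSmooth L g) (hL : 0 < L) (x y : Vec p) :
    g x + inner ℝ (gradient g x) (y - x) + 1 / (2 * L) * ‖gradient g y - gradient g x‖ ^ 2
      ≤ g y := by
  set d := gradient g y - gradient g x with hd
  -- The minorant built at `x` and the majorant built at `y` are compared at the point `y - d / L`,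
  -- which optimizes the comparison.
  have h1 := hg.lower x (y - (1 / L) • d)
  have h2 := hg.upper y (y - (1 / L) • d)
  have e1 : y - (1 / L) • d - x = (y - x) - (1 / L) • d := by abel
  have e2 : y - (1 / L) • d - y = -((1 / L) • d) := by abel
  have e3 : y - (y - (1 / L) • d) = (1 / L) • d := by abel
  rw [e1, inner_sub_right, inner_smul_right] at h1
  rw [e2, e3, inner_neg_right, inner_smul_right, norm_smul, Real.norm_of_nonneg (by positivity)]
    at h2
  have h3 : inner ℝ (gradient g y) d - inner ℝ (gradient g x) d = ‖d‖ ^ 2 := by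
    rw [← inner_sub_left, ← hd, real_inner_self_eq_norm_sq]
  have h4 : L / 2 * (1 / L * ‖d‖) ^ 2 = 1 / (2 * L) * ‖d‖ ^ 2 := by field_simp
  have h5 : 1 / L * ‖d‖ ^ 2 = 2 * (1 / (2 * L) * ‖d‖ ^ 2) := by field_simp
  have h6 : 1 / L * inner ℝ (gradient g y) d - 1 / L * inner ℝ (gradient g x) d
      = 1 / L * ‖d‖ ^ 2 := by rw [← h3]; ring
  linarith

theorem IsConvexSmooth.norm_gradient_sub_sq_le (hg : IsConvexSmooth L g) (hL : 0 < L)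
    (x y : Vec p) : ‖gradient g y - gradient g x‖ ^ 2 ≤ L ^ 2 * ‖y - x‖ ^ 2 := by
  have h1 := hg.cocoercive hL x y
  have h2 := hg.upper x y
  have h3 : 1 / (2 * L) * ‖gradient g y - gradient g x‖ ^ 2 ≤ L / 2 * ‖y - x‖ ^ 2 := by
    rw [norm_sub_rev y x]; linarith
  have h4 : ‖gradient g y - gradient g x‖ ^ 2
      = 2 * L * (1 / (2 * L) * ‖gradient g y - gradient g x‖ ^ 2) := by field_simp
  rw [h4]
  calc _ ≤ 2 * L * (L / 2 * ‖y - x‖ ^ 2) := by gcongr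
    _ = _ := by ring

theorem IsStronglyConvex.lower_bound (hμ : IsStronglyConvex μ g) (hg : Differentiable ℝ g)
    (x y : Vec p) :
    g x + inner ℝ (gradient g x) (y - x) + μ / 2 * ‖y - x‖ ^ 2 ≤ g y := by
  set d := y - x with hd
  -- Along the segment, `φ` is `g` minus the nonconstant part of the claimed minorant. Strong
  -- monotonicity between `x + t d` and `x` carries a factor `t`, which is divided out for `t > 0`.
  let φ : ℝ → ℝ := fun t => g (x + t • d) - t * inner ℝ (gradient g x) d - μ / 2 * ‖d‖ ^ 2 * t ^ 2
  have hφ : ∀ t, HasDerivAt φ (inner ℝ (gradient g (x + t • d)) d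
      - inner ℝ (gradient g x) d - μ * ‖d‖ ^ 2 * t) t := by
    intro t
    have h1 : HasDerivAt (fun t : ℝ => x + t • d) d t := by
      simpa using ((hasDerivAt_id t).smul_const d).const_add x
    have h2 : HasFDerivAt g (fderiv ℝ g (x + t • d)) (x + t • d) :=
      (hg (x + t • d)).hasFDerivAt
    have h3 := h2.comp_hasDerivAt t h1
    have h4 : fderiv ℝ g (x + t • d) d = inner ℝ (gradient g (x + t • d)) d := by
      rw [gradient, InnerProductSpace.toDual_symm_apply]
    rw [h4] at h3
    have h5 := (h3.sub ((hasDerivAt_id t).mul_const (inner ℝ (gradient g x) d))).sub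
      (((hasDerivAt_id t).pow 2).const_mul (μ / 2 * ‖d‖ ^ 2))
    refine h5.congr_deriv ?_
    simp only [id]
    norm_num
    ring
  have hmono : MonotoneOn φ (Set.Icc 0 1) := by
    refine monotoneOn_of_deriv_nonneg (convex_Icc 0 1)
      (fun t _ => (hφ t).continuousAt.continuousWithinAt)
      (fun t _ => (hφ t).differentiableAt.differentiableWithinAt) ?_
    intro t ht
    rw [interior_Icc] at ht
    rw [(hφ t).deriv]
    have h := hμ (x + t • d) x
    rw [add_sub_cancel_left, norm_smul, Real.norm_of_nonneg ht.1.le, inner_smul_left,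
      real_inner_comm, inner_sub_left] at h
    simp only [conj_trivial] at h
    have h' : t * (μ * ‖d‖ ^ 2 * t) ≤ t * (inner ℝ (gradient g (x + t • d)) d
      - inner ℝ (gradient g x) d) := by linarith
    have := le_of_mul_le_mul_left h' ht.1
    linarith
  have h01 := hmono (Set.left_mem_Icc.2 zero_le_one) (Set.right_mem_Icc.2 zero_le_one) zero_le_one
  simp only [φ, zero_smul, add_zero, one_smul, hd, add_sub_cancel] at h01
  linarith

theorem IsStronglyConvex.le_smoothness (hμ : IsStronglyConvex μ g) (hg : IsConvexSmooth L g)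
    (hL : 0 < L) (hp : 0 < p) : μ ≤ L := by
  have : Nonempty (Fin p) := ⟨⟨0, hp⟩⟩
  obtain ⟨x, hx⟩ := exists_ne (0 : Vec p)
  have h1 := hμ x 0
  have h2 := hg.norm_gradient_sub_sq_le hL 0 x
  have h3 : ‖gradient g x - gradient g 0‖ ≤ L * ‖x - 0‖ := by
    rw [← mul_pow] at h2
    exact (pow_le_pow_iff_left₀ (norm_nonneg _) (by positivity) two_ne_zero).1 h2
  have h4 := real_inner_le_norm (x - 0) (gradient g x - gradient g 0)
  have h5 : 0 < ‖x - 0‖ ^ 2 := by rw [sub_zero]; positivity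
  have h6 : ‖x - 0‖ * ‖gradient g x - gradient g 0‖ ≤ ‖x - 0‖ * (L * ‖x - 0‖) := by gcongr
  refine le_of_mul_le_mul_right (a := ‖x - 0‖ ^ 2) ?_ h5
  linarith

theorem gradient_objective {n : ℕ} {f : Fin n → Vec p → ℝ} (hf : ∀ i, Differentiable ℝ (f i))
    (x : Vec p) : gradient (objective f) x = (1 / (n : ℝ)) • ∑ i, gradient (f i) x := by
  have h : HasGradientAt (objective f) ((1 / (n : ℝ)) • ∑ i, gradient (f i) x) x := by
    rw [hasGradientAt_iff_hasFDerivAt, map_smul, map_sum]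
    unfold objective
    refine HasFDerivAt.const_mul (HasFDerivAt.fun_sum fun i _ => ?_) _
    exact hasGradientAt_iff_hasFDerivAt.1 (hf i x).hasGradientAt
  exact h.gradient

theorem isConvexSmooth_objective {n : ℕ} (hn : 0 < n) {f : Fin n → Vec p → ℝ}
    (hf : ∀ i, IsConvexSmooth L (f i)) : IsConvexSmooth L (objective f) := by
  have hn' : (n : ℝ) ≠ 0 := by positivity
  refine ⟨?_, fun x y => ?_, fun x y => ?_⟩
  · unfold objective
    exact (Differentiable.fun_sum fun i _ => (hf i).differentiable).const_mul _
  · rw [gradient_objective (fun i => (hf i).differentiable), inner_smul_left, sum_inner]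
    unfold objective
    simp only [conj_trivial]
    rw [← mul_add, ← Finset.sum_add_distrib]
    gcongr with i
    exact (hf i).lower x y
  · rw [gradient_objective (fun i => (hf i).differentiable), inner_smul_left, sum_inner]
    unfold objective
    simp only [conj_trivial]
    have : L / 2 * ‖x - y‖ ^ 2 = 1 / (n : ℝ) * ∑ _i : Fin n, L / 2 * ‖x - y‖ ^ 2 := by
      rw [Finset.sum_const, Finset.card_univ, Fintype.card_fin, nsmul_eq_mul]; field_simp
    rw [this, ← mul_add, ← mul_add, ← Finset.sum_add_distrib, ← Finset.sum_add_distrib]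
    gcongr with i
    exact (hf i).upper x y

/-- A gradient step of length `1 / L` gains at least this much and cannot go below the minimum. -/
theorem IsConvexSmooth.norm_gradient_sq_le_gap (hg : IsConvexSmooth L g) (hL : 0 < L)
    {xs : Vec p} (hxs : ∀ x, g xs ≤ g x) (x : Vec p) :
    1 / (2 * L) * ‖gradient g x‖ ^ 2 ≤ g x - g xs := by
  have h1 := hg.upper x (x - (1 / L) • gradient g x)
  have h2 := hxs (x - (1 / L) • gradient g x)
  rw [sub_sub_cancel, sub_sub_cancel_left, inner_neg_right, inner_smul_right,
    real_inner_self_eq_norm_sq, norm_smul, Real.norm_of_nonneg (by positivity)] at h1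
  have h4 : L / 2 * (1 / L * ‖gradient g x‖) ^ 2 = 1 / (2 * L) * ‖gradient g x‖ ^ 2 := by field_simp
  have h5 : 1 / L * ‖gradient g x‖ ^ 2 = 2 * (1 / (2 * L) * ‖gradient g x‖ ^ 2) := by field_simp
  linarith

theorem IsConvexSmooth.gap_le (hg : IsConvexSmooth L g) (hL : 0 < L)
    {xs : Vec p} (hxs : ∀ x, g xs ≤ g x) (x : Vec p) :
    g x - g xs ≤ L / 2 * ‖x - xs‖ ^ 2 := by
  have h1 := hg.norm_gradient_sq_le_gap hL hxs xs
  have h2 : gradient g xs = 0 := by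
    rw [sub_self] at h1
    have : ‖gradient g xs‖ ^ 2 ≤ 0 := by
      by_contra! h
      have : 0 < 1 / (2 * L) * ‖gradient g xs‖ ^ 2 := by positivity
      linarith
    simpa using le_antisymm this (by positivity)
  have h3 := hg.upper xs x
  rw [h2, inner_zero_left, norm_sub_rev] at h3
  linarith

/-- Moving from `y` to `u` at most doubles the optimality gap, up to `L ‖u - y‖²`. -/
theorem IsConvexSmooth.gap_le_two_mul (hg : IsConvexSmooth L g) (hL : 0 < L)
    {xs : Vec p} (hxs : ∀ x, g xs ≤ g x) (y u : Vec p) :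
    g u - g xs ≤ 2 * (g y - g xs) + L * ‖u - y‖ ^ 2 := by
  have h1 := hg.norm_gradient_sq_le_gap hL hxs y
  have h2 := hg.upper y u
  have h3 := real_inner_le_norm (gradient g y) (u - y)
  have h4 : ‖gradient g y‖ * ‖u - y‖ ≤ 1 / (2 * L) * ‖gradient g y‖ ^ 2 + L / 2 * ‖u - y‖ ^ 2 := by
    have h := sq_nonneg (‖gradient g y‖ - L * ‖u - y‖)
    have e : 1 / (2 * L) * ‖gradient g y‖ ^ 2 + L / 2 * ‖u - y‖ ^ 2 - ‖gradient g y‖ * ‖u - y‖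
      = 1 / (2 * L) * (‖gradient g y‖ - L * ‖u - y‖) ^ 2 := by field_simp; ring
    have : 0 ≤ 1 / (2 * L) * (‖gradient g y‖ - L * ‖u - y‖) ^ 2 := by positivity
    linarith
  rw [norm_sub_rev y u] at h2
  linarith

end Convexity

/-! ### One step of the accelerated method with an averaged, inexact gradient. -/

section AcceleratedStep

variable {n p : ℕ} {L μ : ℝ} {f : Fin n → Vec p → ℝ}

/-- The average of the Bregman divergences of the `f_i` from `u_i` to `a`. -/
def avgBregman (f : Fin n → Vec p → ℝ) (u : Stack n p) (a : Vec p) : ℝ :=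
  (1 / (n : ℝ)) * ∑ i, (f i a - f i (u i) - inner ℝ (gradient (f i) (u i)) (a - u i))

/-- The mean squared distance of the `u_i` from `a`. -/
def dispersion (u : Stack n p) (a : Vec p) : ℝ := (1 / (n : ℝ)) * ∑ i, ‖u i - a‖ ^ 2

/-- The mean squared distance between `∇f_i(a)` and `∇f_i(u_i)`. -/
def gradDispersion (f : Fin n → Vec p → ℝ) (u : Stack n p) (a : Vec p) : ℝ :=
  (1 / (n : ℝ)) * ∑ i, ‖gradient (f i) a - gradient (f i) (u i)‖ ^ 2

theorem dispersion_nonneg (u : Stack n p) (a : Vec p) : 0 ≤ dispersion u a := by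
  unfold dispersion; positivity

theorem gradDispersion_nonneg (f : Fin n → Vec p → ℝ) (u : Stack n p) (a : Vec p) :
    0 ≤ gradDispersion f u a := by
  unfold gradDispersion; positivity

theorem mean_const (hn : 0 < n) (c : ℝ) : (1 / (n : ℝ)) * ∑ _i : Fin n, c = c := by
  rw [Finset.sum_const, Finset.card_univ, Fintype.card_fin, nsmul_eq_mul]; field_simp

/-- The values `f_i (u_i)` cancel, so the inexactness of the mean gradient is accounted for without
loss. One divergence is later bounded above, the others are kept for their lower bounds. -/
theorem objective_sub_eq (u : Stack n p) (a b : Vec p) :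
    objective f a - objective f b =
      inner ℝ (rowMean fun i => gradient (f i) (u i)) (a - b)
        + avgBregman f u a - avgBregman f u b := by
  unfold objective rowMean avgBregman
  rw [inner_smul_left, sum_inner, conj_trivial, ← mul_add, ← mul_sub, ← mul_sub,
    ← Finset.sum_sub_distrib, ← Finset.sum_add_distrib, ← Finset.sum_sub_distrib]
  congr 1
  refine Finset.sum_congr rfl fun i _ => ?_
  rw [show a - b = (a - u i) - (b - u i) by abel, inner_sub_right]
  ring

theorem gradDispersion_le_avgBregman (hL : 0 < L) (hf : ∀ i, IsConvexSmooth L (f i))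
    (u : Stack n p) (a : Vec p) :
    1 / (2 * L) * gradDispersion f u a ≤ avgBregman f u a := by
  unfold gradDispersion avgBregman
  rw [mul_left_comm, Finset.mul_sum]
  gcongr with i
  linarith [(hf i).cocoercive hL (u i) a]

theorem dispersion_le_avgBregman (hf : ∀ i, Differentiable ℝ (f i))
    (hfμ : ∀ i, IsStronglyConvex μ (f i)) (u : Stack n p) (a : Vec p) :
    μ / 2 * dispersion u a ≤ avgBregman f u a := by
  unfold dispersion avgBregman
  rw [mul_left_comm, Finset.mul_sum]
  gcongr with i
  rw [norm_sub_rev]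
  linarith [(hfμ i).lower_bound (hf i) (u i) a]

theorem avgBregman_le_dispersion (hf : ∀ i, IsConvexSmooth L (f i)) (u : Stack n p) (a : Vec p) :
    avgBregman f u a ≤ L / 2 * dispersion u a := by
  unfold dispersion avgBregman
  rw [mul_left_comm (L / 2), Finset.mul_sum _ _ (L / 2)]
  gcongr with i
  linarith [(hf i).upper (u i) a]

theorem norm_add_sq_le_two {E : Type*} [SeminormedAddCommGroup E] (a b : E) :
    ‖a + b‖ ^ 2 ≤ 2 * ‖a‖ ^ 2 + 2 * ‖b‖ ^ 2 := by
  have h1 : ‖a + b‖ ^ 2 ≤ (‖a‖ + ‖b‖) ^ 2 := by gcongr; exact norm_add_le a b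
  nlinarith [sq_nonneg (‖a‖ - ‖b‖)]

theorem dispersion_le_two_mul (hn : 0 < n) (u : Stack n p) (a b : Vec p) :
    dispersion u a ≤ 2 * ‖a - b‖ ^ 2 + 2 * dispersion u b := by
  rw [← mean_const hn (2 * ‖a - b‖ ^ 2)]
  unfold dispersion
  rw [mul_left_comm 2, Finset.mul_sum _ _ (2 : ℝ), ← mul_add, ← Finset.sum_add_distrib]
  gcongr with i
  have h := norm_add_sq_le_two (u i - b) (b - a)
  rw [sub_add_sub_cancel, norm_sub_rev b a] at h
  linarith

/-- Young's inequality in the form `(s + t)² ≤ 3/2 s² + 3 t²`. It lets strong convexity at the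
scattered points be used at their mean. -/
theorem le_dispersion (hn : 0 < n) (u : Stack n p) (a b : Vec p) :
    2 / 3 * ‖a - b‖ ^ 2 - 2 * dispersion u b ≤ dispersion u a := by
  rw [← mean_const hn (2 / 3 * ‖a - b‖ ^ 2)]
  unfold dispersion
  rw [mul_left_comm 2, Finset.mul_sum _ _ (2 : ℝ), ← mul_sub, ← Finset.sum_sub_distrib]
  gcongr with i
  have h : ‖a - b‖ ≤ ‖u i - a‖ + ‖u i - b‖ := by
    rw [norm_sub_rev (u i) a]; exact norm_sub_le_norm_sub_add_norm_sub a (u i) b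
  have h2 : ‖a - b‖ ^ 2 ≤ (‖u i - a‖ + ‖u i - b‖) ^ 2 := by gcongr
  nlinarith [sq_nonneg (‖u i - a‖ - 2 * ‖u i - b‖)]

/-- The mean squared change of the local gradients is controlled by the divergences which the
accelerated step makes decrease; `x⁺ = x - η g`. -/
theorem mean_gradient_diff_le (hn : 0 < n) (hL : 0 < L) (hf : ∀ i, IsConvexSmooth L (f i))
    {τ : ℝ} (hτ : 0 ≤ τ) (hτ1 : τ ≤ 1) (u u' : Stack n p) (x y y' xs d : Vec p)
    (hy' : y' = x - d) :
    (1 / (n : ℝ)) * ∑ i, ‖gradient (f i) (u' i) - gradient (f i) (u i)‖ ^ 2 ≤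
      2 * ((1 - τ) * gradDispersion f u' y' + τ * gradDispersion f u' xs)
      + 2 * ((1 - τ) * gradDispersion f u y + τ * gradDispersion f u xs)
      + 4 * L ^ 2 * ‖d‖ ^ 2 + 4 * L ^ 2 * dispersion u x := by
  -- The difference is estimated twice, by passing through `y'` here and through `xs` below. The two
  -- estimates are averaged with weights `1 - τ` and `τ`, because the accelerated step supplies its
  -- surplus with exactly these weights.
  have h1 : (1 / (n : ℝ)) * ∑ i, ‖gradient (f i) (u' i) - gradient (f i) (u i)‖ ^ 2 ≤
      2 * gradDispersion f u' y' + 4 * L ^ 2 * ‖d‖ ^ 2 + 4 * L ^ 2 * dispersion u x := by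
    have h2 := dispersion_le_two_mul hn u y' x
    rw [hy', sub_sub_cancel_left, norm_neg, ← hy'] at h2
    have h3 : (1 / (n : ℝ)) * ∑ i, ‖gradient (f i) (u' i) - gradient (f i) (u i)‖ ^ 2 ≤
        2 * gradDispersion f u' y' + 2 * L ^ 2 * dispersion u y' := by
      unfold gradDispersion dispersion
      rw [mul_left_comm 2, mul_left_comm (2 * L ^ 2), ← mul_add, Finset.mul_sum _ _ (2 : ℝ),
        Finset.mul_sum _ _ (2 * L ^ 2), ← Finset.sum_add_distrib]
      gcongr with i
      have h4 := norm_add_sq_le_two (gradient (f i) (u' i) - gradient (f i) y')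
        (gradient (f i) y' - gradient (f i) (u i))
      rw [sub_add_sub_cancel, norm_sub_rev (gradient (f i) (u' i)) (gradient (f i) y')] at h4
      have h5 := (hf i).norm_gradient_sub_sq_le hL (u i) y'
      rw [norm_sub_rev y'] at h5
      linarith
    have : 2 * L ^ 2 * dispersion u y' ≤ 2 * L ^ 2 * (2 * ‖d‖ ^ 2 + 2 * dispersion u x) := by
      gcongr
    linarith
  have h2 : (1 / (n : ℝ)) * ∑ i, ‖gradient (f i) (u' i) - gradient (f i) (u i)‖ ^ 2 ≤
      2 * gradDispersion f u' xs + 2 * gradDispersion f u xs := by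
    unfold gradDispersion
    rw [mul_left_comm 2, mul_left_comm 2, ← mul_add, Finset.mul_sum _ _ (2 : ℝ),
      Finset.mul_sum _ _ (2 : ℝ), ← Finset.sum_add_distrib]
    gcongr with i
    have h4 := norm_add_sq_le_two (gradient (f i) (u' i) - gradient (f i) xs)
      (gradient (f i) xs - gradient (f i) (u i))
    rwa [sub_add_sub_cancel, norm_sub_rev (gradient (f i) (u' i)) (gradient (f i) xs)] at h4
  have h3 := mul_le_mul_of_nonneg_left h1 (sub_nonneg.2 hτ1)
  have h4 := mul_le_mul_of_nonneg_left h2 hτ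
  have h5 : 0 ≤ τ * (4 * L ^ 2 * ‖d‖ ^ 2 + 4 * L ^ 2 * dispersion u x) := by
    have := dispersion_nonneg u x
    positivity
  have h6 : 0 ≤ (1 - τ) * gradDispersion f u y :=
    mul_nonneg (sub_nonneg.2 hτ1) (gradDispersion_nonneg _ _ _)
  nlinarith

/-- One step of the inexact accelerated gradient method on the averages. -/
theorem accelerated_step (hn : 0 < n) (hL : 0 < L) (hμ : 0 < μ) (hμL : μ ≤ L)
    (hf : ∀ i, IsConvexSmooth L (f i)) (hfμ : ∀ i, IsStronglyConvex μ (f i))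
    {xs : Vec p} {α β τ η : ℝ}
    (hα : α * τ = 1 / 12) (hτ : 0 < τ) (hτ1 : τ < 1) (hη : 0 < η) (hLη : L * η ≤ 1 / 2)
    (hβ : 0 < β) (hβ16 : β ≤ 1 / 16) (hβμ : β ≤ μ * α * η / 2)
    (u : Stack n p) {x y z y' z' g : Vec p} (hg : g = rowMean fun i => gradient (f i) (u i))
    (hx : x = (1 - τ) • y + τ • z) (hy' : y' = x - η • g)
    (hz' : z' = (1 - β) • z + β • x - (α * η) • g) :
    12 * (1 - β + β * τ) * (objective f y' - objective f xs) + 72 * τ ^ 2 / η * ‖z' - xs‖ ^ 2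
      + 5 * η * ‖g‖ ^ 2
      + 3 / (2 * L) * ((1 - τ) * gradDispersion f u y + τ * gradDispersion f u xs)
      ≤ (1 - β) * (12 * (1 - τ) * (objective f y - objective f xs)
          + 72 * τ ^ 2 / η * ‖z - xs‖ ^ 2) + 21 * L * dispersion u x := by
  have hατ : α = 1 / (12 * τ) := by field_simp; linarith
  -- This is `1 / (2 α² η)`, so that expanding the square produces `12 τ ⟨g, q⟩` and `η / 2 ‖g‖²`.
  set θ := 72 * τ ^ 2 / η with hθ
  have hθ0 : 0 < θ := by positivity
  -- the quadratic term
  set q := (1 - β) • (z - xs) + β • (x - xs) with hq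
  have hzq : z' - xs = q - (α * η) • g := by
    rw [hz', hq]; module
  have e1 : ‖z' - xs‖ ^ 2 = ‖q‖ ^ 2 - 2 * (α * η) * inner ℝ g q + (α * η) ^ 2 * ‖g‖ ^ 2 := by
    rw [hzq, norm_sub_sq_real, inner_smul_right, norm_smul, mul_pow, Real.norm_eq_abs, sq_abs,
      real_inner_comm]
    ring
  have e2 : ‖q‖ ^ 2 ≤ (1 - β) * ‖z - xs‖ ^ 2 + β * ‖x - xs‖ ^ 2 := by
    have h := norm_add_sq_real ((1 - β) • (z - xs)) (β • (x - xs))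
    have h' := norm_sub_sq_real (z - xs) (x - xs)
    rw [inner_smul_left, inner_smul_right, norm_smul, norm_smul, mul_pow, mul_pow,
      Real.norm_eq_abs, Real.norm_eq_abs, sq_abs, sq_abs, ← hq] at h
    simp only [conj_trivial] at h
    have h3 : 0 ≤ (1 - β) * β * ‖z - xs - (x - xs)‖ ^ 2 := by
      have : 0 ≤ 1 - β := by linarith
      positivity
    rw [h'] at h3
    rw [h]
    linarith
  -- the linear terms
  have hzx : τ • (z - x) = (1 - τ) • (x - y) := by rw [hx]; module
  have e3 : τ * inner ℝ g (z - x) = (1 - τ) * inner ℝ g (x - y) := by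
    rw [← inner_smul_right, ← inner_smul_right, hzx]
  have e4 : inner ℝ g q = (1 - β) * inner ℝ g (z - x) + inner ℝ g (x - xs) := by
    rw [← inner_smul_right, ← inner_add_right, hq]
    congr 1; module
  have e5 : ∀ a, inner ℝ g (x - a) = η * ‖g‖ ^ 2 + (objective f y' - objective f a)
      - avgBregman f u y' + avgBregman f u a := by
    intro a
    have h := objective_sub_eq (f := f) u y' a
    rw [← hg] at h
    have h2 : x - a = η • g + (y' - a) := by rw [hy']; module
    rw [h2, inner_add_right, inner_smul_right, real_inner_self_eq_norm_sq]
    linarith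
  have e6 := e5 xs
  have e7 := e5 y
  -- the divergences
  have b1 : avgBregman f u y' ≤ L * η ^ 2 * ‖g‖ ^ 2 + L * dispersion u x := by
    have h1 := avgBregman_le_dispersion hf u y'
    have h2 := dispersion_le_two_mul hn u y' x
    have h3 : y' - x = -(η • g) := by rw [hy']; abel
    rw [h3, norm_neg, norm_smul, mul_pow, Real.norm_eq_abs, sq_abs] at h2
    have h4 : L / 2 * dispersion u y' ≤ L / 2 * (2 * (η ^ 2 * ‖g‖ ^ 2) + 2 * dispersion u x) := by
      gcongr
    linarith
  have b2 : 1 / (2 * L) * gradDispersion f u y ≤ avgBregman f u y :=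
    gradDispersion_le_avgBregman hL hf u y
  have b3 : 1 / (2 * L) * gradDispersion f u xs ≤ avgBregman f u xs :=
    gradDispersion_le_avgBregman hL hf u xs
  have b4 : μ / 3 * ‖x - xs‖ ^ 2 - μ * dispersion u x ≤ avgBregman f u xs := by
    have h1 := dispersion_le_avgBregman (fun i => (hf i).differentiable) hfμ u xs
    have h2 := le_dispersion hn u xs x
    rw [norm_sub_rev] at h2
    have h3 := mul_le_mul_of_nonneg_left h2 (by positivity : 0 ≤ μ / 2)
    linarith
  set D := dispersion u x with hD
  have hD0 : 0 ≤ D := dispersion_nonneg u x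
  set G := ‖g‖ ^ 2 with hG
  have hG0 : 0 ≤ G := by positivity
  set By := avgBregman f u y
  set By' := avgBregman f u y'
  set Bs := avgBregman f u xs
  set φ' := objective f y' - objective f xs with hφ'
  set φ := objective f y - objective f xs with hφ
  have hφφ : objective f y' - objective f y = φ' - φ := by rw [hφ, hφ']; ring
  rw [hφφ] at e7
  -- The total weight of `f(y') - f(xs)`: the comparison with `xs` contributes `τ`, the one with `y`
  -- contributes `(1 - β)(1 - τ)`.
  set c := 12 * (τ + (1 - β) * (1 - τ)) with hc
  have hc0 : c = 12 * (1 - β + β * τ) := by rw [hc]; ring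
  have hβτ : β * τ ≤ β := mul_le_of_le_one_right hβ.le hτ1.le
  have hβτ0 : 0 < β * τ := mul_pos hβ hτ
  have hc1 : c ≤ 12 := by linarith
  have hc2 : 45 / 4 ≤ c := by linarith
  clear_value c
  -- The bound on `β` in terms of `μ` is used here: the term `θ β ‖x - xs‖²` becomes small enough
  -- for the divergence at `xs` to absorb.
  have t1 : θ * ‖z' - xs‖ ^ 2 ≤ (1 - β) * (θ * ‖z - xs‖ ^ 2) + 3 * τ * μ * ‖x - xs‖ ^ 2
      - 12 * τ * inner ℝ g q + η / 2 * G := by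
    have h1 : θ * (2 * (α * η)) = 12 * τ := by rw [hθ, hατ]; field_simp; ring
    have h2 : θ * (α * η) ^ 2 = η / 2 := by rw [hθ, hατ]; field_simp; ring
    have h3 : θ * β ≤ 3 * τ * μ := by
      calc θ * β ≤ θ * (μ * α * η / 2) := by gcongr
        _ = 3 * τ * μ := by rw [hθ, hατ]; field_simp; ring
    have h4 : θ * β * ‖x - xs‖ ^ 2 ≤ 3 * τ * μ * ‖x - xs‖ ^ 2 := by gcongr
    have h5 : θ * ‖q‖ ^ 2 ≤ θ * ((1 - β) * ‖z - xs‖ ^ 2 + β * ‖x - xs‖ ^ 2) := by gcongr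
    have h6 : θ * ‖z' - xs‖ ^ 2 = θ * ‖q‖ ^ 2 - θ * (2 * (α * η)) * inner ℝ g q
        + θ * (α * η) ^ 2 * G := by rw [e1]; ring
    rw [h1, h2] at h6
    linarith
  have t2 : 12 * τ * inner ℝ g q = c * (η * G + φ' - By') - 12 * (1 - β) * (1 - τ) * (φ - By)
      + 12 * τ * Bs := by
    have h : τ * inner ℝ g q = (1 - β) * (τ * inner ℝ g (z - x)) + τ * inner ℝ g (x - xs) := by
      rw [e4]; ring
    rw [e3, e6, e7] at h
    rw [mul_assoc 12, h, hc]
    ring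
  have t3 : c * By' ≤ c * (η / 2 * G) + 12 * L * D := by
    have h1 : L * η ^ 2 * G ≤ η / 2 * G := by
      have : L * η ^ 2 ≤ η / 2 := by
        calc L * η ^ 2 = L * η * η := by ring
          _ ≤ 1 / 2 * η := by gcongr
          _ = η / 2 := by ring
      gcongr
    have h2 : c * By' ≤ c * (η / 2 * G + L * D) := by
      have : 0 ≤ c := by linarith
      gcongr
      linarith
    have h3 : c * (L * D) ≤ 12 * (L * D) := by gcongr
    linarith
  have t4 : 45 / 8 * (η * G) ≤ c * (η / 2 * G) := by
    have : 0 ≤ η / 2 * G := by positivity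
    calc 45 / 8 * (η * G) = 45 / 4 * (η / 2 * G) := by ring
      _ ≤ _ := by gcongr
  have t5 : 3 / (2 * L) * ((1 - τ) * gradDispersion f u y) ≤ 12 * (1 - β) * (1 - τ) * By := by
    have h0 := gradDispersion_nonneg f u y
    have h1 : 0 ≤ By := le_trans (by positivity) b2
    have h2 : 3 / (2 * L) * ((1 - τ) * gradDispersion f u y)
        = 3 * (1 - τ) * (1 / (2 * L) * gradDispersion f u y) := by field_simp
    rw [h2]
    have h3 : 0 ≤ 1 - τ := by linarith
    calc _ ≤ 3 * (1 - τ) * By := by gcongr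
      _ ≤ 12 * (1 - β) * (1 - τ) * By := by
        gcongr
        linarith
  have t6 : 3 / (2 * L) * (τ * gradDispersion f u xs) + 3 * τ * μ * ‖x - xs‖ ^ 2
      ≤ 12 * τ * Bs + 9 * L * D := by
    have h2 : 3 / (2 * L) * (τ * gradDispersion f u xs)
        = 3 * τ * (1 / (2 * L) * gradDispersion f u xs) := by field_simp
    have h3 := mul_le_mul_of_nonneg_left b3 (by positivity : 0 ≤ 3 * τ)
    have h4 := mul_le_mul_of_nonneg_left b4 (by positivity : 0 ≤ 9 * τ)
    have h5 : τ * (μ * D) ≤ 1 * (L * D) := by gcongr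
    linarith
  rw [← hc0]
  have : 0 ≤ η * G := by positivity
  linarith

end AcceleratedStep

/-! ### The Perron vector and the spectral gap. -/

section Perron

variable {n : ℕ} {𝒢 : Digraph (Fin n)} {C : Matrix (Fin n) (Fin n) ℝ} {q : Fin n → ℝ}

theorem sum_mulVec_of_col_sum {𝕜 : Type*} [CommSemiring 𝕜] {A : Matrix (Fin n) (Fin n) 𝕜}
    {c : 𝕜} (hA : ∀ j, ∑ i, A i j = c) (x : Fin n → 𝕜) :
    ∑ i, A.mulVec x i = c * ∑ i, x i := by
  simp only [Matrix.mulVec, dotProduct]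
  rw [Finset.sum_comm, Finset.mul_sum]
  exact Finset.sum_congr rfl fun j _ => by rw [← Finset.sum_mul, hA]

theorem col_sum_pow (hC : ∀ j, ∑ i, C i j = 1) (l : ℕ) (j : Fin n) : ∑ i, (C ^ l) i j = 1 := by
  induction l with
  | zero => simp [Matrix.one_apply]
  | succ l ih =>
    have := sum_mulVec_of_col_sum hC (fun i => (C ^ l) i j)
    rw [ih, one_mul] at this
    rw [pow_succ', ← this]
    rfl

/-- A positive column stochastic matrix is a strict `ℓ¹`-contraction on zero-sum vectors. -/
theorem exists_l1_contraction (hn : 0 < n) {P : Matrix (Fin n) (Fin n) ℝ}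
    (hP : ∀ i j, 0 < P i j) (hP1 : ∀ j, ∑ i, P i j = 1) :
    ∃ r : ℝ, r < 1 ∧ ∀ x : Fin n → ℂ, ∑ i, x i = 0 →
      ∑ i, ‖(P.map (algebraMap ℝ ℂ)).mulVec x i‖ ≤ r * ∑ i, ‖x i‖ := by
  have : Nonempty (Fin n × Fin n) := ⟨(⟨0, hn⟩, ⟨0, hn⟩)⟩
  obtain ⟨⟨i₀, j₀⟩, h₀⟩ := Finite.exists_min fun s : Fin n × Fin n => P s.1 s.2
  -- Doeblin's argument: subtracting the smallest entry everywhere does not change the action on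
  -- zero-sum vectors, and leaves a nonnegative matrix with column sums `1 - n ε`.
  set ε := P i₀ j₀ with hε
  refine ⟨1 - n * ε, ?_, fun x hx => ?_⟩
  · have := hP i₀ j₀
    have : 0 < n * ε := by positivity
    linarith
  have key : ∀ i, ‖(P.map (algebraMap ℝ ℂ)).mulVec x i‖ ≤ ∑ j, (P i j - ε) * ‖x j‖ := by
    intro i
    have h : (P.map (algebraMap ℝ ℂ)).mulVec x i = ∑ j, ((P i j - ε : ℝ) : ℂ) * x j := by
      simp only [Matrix.mulVec, dotProduct, Matrix.map_apply, Complex.coe_algebraMap,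
        Complex.ofReal_sub, sub_mul, Finset.sum_sub_distrib]
      rw [← Finset.mul_sum, hx, mul_zero, sub_zero]
    rw [h]
    refine (norm_sum_le _ _).trans (Finset.sum_le_sum fun j _ => ?_)
    rw [norm_mul, Complex.norm_real, Real.norm_of_nonneg (sub_nonneg.2 (h₀ (i, j)))]
  refine (Finset.sum_le_sum fun i _ => key i).trans_eq ?_
  rw [Finset.sum_comm, Finset.mul_sum]
  refine Finset.sum_congr rfl fun j _ => ?_
  rw [← Finset.sum_mul, Finset.sum_sub_distrib, hP1]
  simp

theorem eq_zero_of_l1_le {r : ℝ} (hr : r < 1) {x : Fin n → ℂ}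
    (h : ∑ i, ‖x i‖ ≤ r * ∑ i, ‖x i‖) : x = 0 := by
  have h0 : 0 ≤ ∑ i, ‖x i‖ := by positivity
  have h1 : ∑ i, ‖x i‖ = 0 := by
    by_contra hne
    have : 0 < ∑ i, ‖x i‖ := lt_of_le_of_ne h0 (Ne.symm hne)
    nlinarith
  funext i
  have := (Finset.sum_eq_zero_iff_of_nonneg (fun i _ => norm_nonneg (x i))).1 h1 i
    (Finset.mem_univ i)
  simpa using this

theorem pow_mulVec_eq_of_mulVec_eq {R : Type*} [CommSemiring R] {A : Matrix (Fin n) (Fin n) R}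
    {x : Fin n → R} {c : R} (h : A.mulVec x = c • x) (l : ℕ) : (A ^ l).mulVec x = c ^ l • x := by
  induction l with
  | zero => simp
  | succ l ih => rw [pow_succ, ← Matrix.mulVec_mulVec, h, Matrix.mulVec_smul, ih, smul_smul,
      pow_succ']

/-- The difference of two candidates is a zero-sum vector fixed by a positive power of `C`, which
strictly contracts such vectors. -/
theorem IsPerronVector.unique (hn : 0 < n) (hC : IsMixingMatrix 𝒢 C) {q q' : Fin n → ℝ}
    (hq : IsPerronVector C q) (hq' : IsPerronVector C q') : q = q' := by
  obtain ⟨l, hl⟩ := hC.regular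
  obtain ⟨r, hr, h⟩ := exists_l1_contraction hn hl (col_sum_pow hC.col_sum l)
  set d := q - q' with hd
  have hCd : C.mulVec d = (1 : ℝ) • d := by
    rw [hd, Matrix.mulVec_sub, hq.eigen, hq'.eigen, one_smul]
  have hpow := pow_mulVec_eq_of_mulVec_eq hCd l
  have hs : ∑ i, ((algebraMap ℝ ℂ) ∘ d) i = 0 := by
    simp [hd, ← Complex.ofReal_sum, hq.sum_eq, hq'.sum_eq]
  have hd0 : (algebraMap ℝ ℂ) ∘ d = 0 := by
    refine eq_zero_of_l1_le hr ?_
    have h1 := h _ hs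
    rw [show ((C ^ l).map (algebraMap ℝ ℂ)).mulVec ((algebraMap ℝ ℂ) ∘ d)
      = (algebraMap ℝ ℂ) ∘ ((C ^ l).mulVec d) from
        funext fun i => (RingHom.map_mulVec (algebraMap ℝ ℂ) (C ^ l) d i).symm, hpow] at h1
    simpa using h1
  funext i
  have := congrFun hd0 i
  simpa [hd, sub_eq_zero, ← Complex.ofReal_sub] using this

/-- The all-ones vector is a left eigenvector, so `C - 1` is singular. For a kernel vector `x`, `|x|
≤ C |x|` entrywise while both sides have the same sum, hence `|x|` is fixed too; a positive power of
`C` makes it positive. -/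
theorem exists_isPerronVector (hn : 0 < n) (hC : IsMixingMatrix 𝒢 C) :
    ∃ q, IsPerronVector C q := by
  have : Nonempty (Fin n) := ⟨⟨0, hn⟩⟩
  have hdet : (C - 1).det = 0 := by
    rw [← Matrix.det_transpose]
    refine Matrix.exists_mulVec_eq_zero_iff.1 ⟨fun _ => 1, fun h => ?_, ?_⟩
    · simpa using congrFun h ⟨0, hn⟩
    · funext j
      simp [Matrix.mulVec, dotProduct, Matrix.transpose_apply, Finset.sum_sub_distrib,
        hC.col_sum, Matrix.one_apply]
  obtain ⟨x, hx0, hx⟩ := Matrix.exists_mulVec_eq_zero_iff.2 hdet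
  rw [Matrix.sub_mulVec, Matrix.one_mulVec, sub_eq_zero] at hx
  set a : Fin n → ℝ := fun i => |x i| with ha
  have hle : ∀ i, a i ≤ C.mulVec a i := by
    intro i
    have h := congrFun hx i
    simp only [ha]
    rw [← h]
    simp only [Matrix.mulVec, dotProduct]
    refine (Finset.abs_sum_le_sum_abs _ _).trans_eq ?_
    exact Finset.sum_congr rfl fun j _ => by rw [abs_mul, abs_of_nonneg (hC.nonneg i j)]
  have hsum : ∑ i, C.mulVec a i = ∑ i, a i := by
    rw [sum_mulVec_of_col_sum hC.col_sum, one_mul]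
  have hCa : C.mulVec a = (1 : ℝ) • a := by
    rw [one_smul]
    funext i
    exact ((Finset.sum_eq_sum_iff_of_le fun i _ => hle i).1 hsum.symm i (Finset.mem_univ i)).symm
  obtain ⟨j, hj⟩ : ∃ j, x j ≠ 0 := by
    by_contra! h
    exact hx0 (funext h)
  have hj' : 0 < a j := abs_pos.2 hj
  have ha0 : ∀ i, 0 ≤ a i := fun i => abs_nonneg _
  obtain ⟨l, hl⟩ := hC.regular
  have hpos : ∀ i, 0 < a i := by
    intro i
    have h := congrFun (pow_mulVec_eq_of_mulVec_eq hCa l) i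
    rw [one_pow, one_smul] at h
    rw [← h]
    exact Finset.sum_pos' (fun k _ => mul_nonneg (hl i k).le (ha0 k))
      ⟨j, Finset.mem_univ j, mul_pos (hl i j) hj'⟩
  have hS : 0 < ∑ i, a i := Finset.sum_pos (fun i _ => hpos i) Finset.univ_nonempty
  refine ⟨((n : ℝ) / ∑ i, a i) • a, fun i => ?_, ?_, ?_⟩
  · have := hpos i
    simp only [Pi.smul_apply, smul_eq_mul]
    positivity
  · rw [Matrix.mulVec_smul, hCa, one_smul]
  · simp only [Pi.smul_apply, smul_eq_mul, ← Finset.mul_sum]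
    field_simp

theorem rankOne_mulVec (x : Fin n → ℝ) (i : Fin n) :
    (rankOne q).mulVec x i = q i * ((1 / (n : ℝ)) * ∑ j, x j) := by
  simp only [Matrix.mulVec, dotProduct, rankOne, Matrix.of_apply]
  rw [Finset.mul_sum, Finset.mul_sum]
  exact Finset.sum_congr rfl fun j _ => by ring

theorem rankOne_mul (hC : ∀ j, ∑ i, C i j = 1) : rankOne q * C = rankOne q := by
  ext i j
  simp only [rankOne, Matrix.mul_apply, Matrix.of_apply]
  rw [← Finset.mul_sum, hC, mul_one]

theorem mul_rankOne (hq : IsPerronVector C q) : C * rankOne q = rankOne q := by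
  ext i j
  have h := congrFun hq.eigen i
  simp only [Matrix.mulVec, dotProduct] at h
  simp only [rankOne, Matrix.mul_apply, Matrix.of_apply]
  rw [← h, Finset.sum_div]
  exact Finset.sum_congr rfl fun k _ => by ring

theorem IsPerronVector.col_sum_rankOne (hn : 0 < n) (hq : IsPerronVector C q) (j : Fin n) :
    ∑ i, rankOne q i j = 1 := by
  simp only [rankOne, Matrix.of_apply]
  rw [← Finset.sum_div, hq.sum_eq, div_self (by positivity)]

theorem one_sub_rankOne_mul (hn : 0 < n) (hC : IsMixingMatrix 𝒢 C) (hq : IsPerronVector C q) :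
    (1 - rankOne q) * C = (C - rankOne q) * (1 - rankOne q) := by
  rw [sub_mul, sub_mul, mul_sub, mul_sub, rankOne_mul hC.col_sum, mul_rankOne hq,
    rankOne_mul (hq.col_sum_rankOne hn)]
  simp

/-- The columns of `C - rankOne q` sum to zero, so an eigenvector for a nonzero eigenvalue is
zero-sum and is also an eigenvector of `C`. Modulus at least one would contradict the
`ℓ¹`-contraction. -/
theorem spectralRadius_lt_one (hn : 0 < n) (hC : IsMixingMatrix 𝒢 C) (hq : IsPerronVector C q) :
    spectralRadius ℂ ((C - rankOne q).map (algebraMap ℝ ℂ)) < ((1 : NNReal) : ENNReal) := by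
  have : Nonempty (Fin n) := ⟨⟨0, hn⟩⟩
  let _ := Matrix.instL2OpNormedRing (𝕜 := ℂ) (n := Fin n)
  let _ := Matrix.instL2OpNormedAlgebra (𝕜 := ℂ) (n := Fin n)
  set B := (C - rankOne q).map (algebraMap ℝ ℂ) with hB
  obtain ⟨l, hl⟩ := hC.regular
  obtain ⟨r, hr, h⟩ := exists_l1_contraction hn hl (col_sum_pow hC.col_sum l)
  refine spectrum.spectralRadius_lt_of_forall_lt B fun k hk => ?_
  rw [← Matrix.spectrum_toLin', ← Module.End.hasEigenvalue_iff_mem_spectrum] at hk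
  obtain ⟨x, hx⟩ := hk.exists_hasEigenvector
  have hx1 : B.mulVec x = k • x := by simpa using hx.apply_eq_smul
  by_contra! hk1
  have hk1' : 1 ≤ ‖k‖ := by exact_mod_cast hk1
  have hk0 : k ≠ 0 := by
    rintro rfl
    simp at hk1'
    linarith
  have hs : ∑ i, x i = 0 := by
    have hcol : ∀ j, ∑ i, B i j = 0 := by
      intro j
      simp only [hB, Matrix.map_apply, Matrix.sub_apply]
      rw [← map_sum, Finset.sum_sub_distrib, hC.col_sum, hq.col_sum_rankOne hn]
      simp
    have h1 := sum_mulVec_of_col_sum hcol x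
    rw [hx1, zero_mul] at h1
    simp only [Pi.smul_apply, smul_eq_mul, ← Finset.mul_sum] at h1
    exact (mul_eq_zero.1 h1).resolve_left hk0
  have hCx : (C.map (algebraMap ℝ ℂ)).mulVec x = k • x := by
    rw [← hx1, hB]
    funext i
    simp only [Matrix.mulVec, dotProduct, Matrix.map_apply, Matrix.sub_apply, map_sub, sub_mul,
      Finset.sum_sub_distrib, rankOne, Matrix.of_apply]
    rw [← Finset.mul_sum, hs, mul_zero, sub_zero]
  have hpow := pow_mulVec_eq_of_mulVec_eq hCx l
  have h1 := h x hs
  rw [show (C ^ l).map (algebraMap ℝ ℂ) = (C.map (algebraMap ℝ ℂ)) ^ l from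
    Matrix.map_pow C (algebraMap ℝ ℂ) l, hpow] at h1
  simp only [Pi.smul_apply, smul_eq_mul, norm_mul, norm_pow, ← Finset.mul_sum] at h1
  have h2 : (1 : ℝ) ≤ ‖k‖ ^ l := one_le_pow₀ hk1'
  have h3 : 0 ≤ ∑ i, ‖x i‖ := by positivity
  refine hx.2 (eq_zero_of_l1_le hr (le_trans ?_ h1))
  nlinarith

theorem rho_lt_one (hn : 0 < n) (hC : IsMixingMatrix 𝒢 C) (hq : IsPerronVector C q) :
    rho (C - rankOne q) < 1 := by
  have hlt := spectralRadius_lt_one hn hC hq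
  have := (ENNReal.toReal_lt_toReal hlt.ne_top (by simp)).2 hlt
  rwa [ENNReal.coe_toReal, NNReal.coe_one] at this

end Perron

/-! ### Uniform positivity of the weights. -/

section Weights

variable {n : ℕ} {𝒢 : Digraph (Fin n)} {C : Matrix (Fin n) (Fin n) ℝ} {v₀ : Fin n → ℝ}

theorem sum_weights (hC : ∀ j, ∑ i, C i j = 1) (hv₀n : ∑ i, v₀ i = n) (k : ℕ) :
    ∑ i, weights C v₀ k i = n := by
  induction k with
  | zero => exact hv₀n
  | succ k ih => rw [weights, sum_mulVec_of_col_sum hC, ih, one_mul]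

/-- An entrywise comparison with a positive multiple of the Perron vector is preserved by the
nonnegative matrix `C`. -/
theorem exists_pos_le_weights (hn : 0 < n) (hC : IsMixingMatrix 𝒢 C) (hv₀ : ∀ i, 0 < v₀ i) :
    ∃ c > 0, ∀ k i, c ≤ weights C v₀ k i := by
  have : Nonempty (Fin n) := ⟨⟨0, hn⟩⟩
  obtain ⟨q, hq⟩ := exists_isPerronVector hn hC
  obtain ⟨i₀, h₀⟩ := Finite.exists_min fun i => v₀ i / q i
  obtain ⟨i₁, h₁⟩ := Finite.exists_min q
  have hc : 0 < v₀ i₀ / q i₀ := div_pos (hv₀ _) (hq.pos _)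
  have key : ∀ k i, v₀ i₀ / q i₀ * q i ≤ weights C v₀ k i := by
    intro k
    induction k with
    | zero => exact fun i => (le_div_iff₀ (hq.pos i)).1 (h₀ i)
    | succ k ih =>
      intro i
      have h := congrFun hq.eigen i
      rw [← h, weights]
      simp only [Matrix.mulVec, dotProduct]
      rw [Finset.mul_sum]
      refine Finset.sum_le_sum fun j _ => ?_
      rw [mul_left_comm]
      exact mul_le_mul_of_nonneg_left (ih j) (hC.nonneg i j)
  exact ⟨v₀ i₀ / q i₀ * q i₁, mul_pos hc (hq.pos _), fun k i =>
    (mul_le_mul_of_nonneg_left (h₁ i) hc.le).trans (key k i)⟩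

theorem weights_pos (hn : 0 < n) (hC : IsMixingMatrix 𝒢 C) (hv₀ : ∀ i, 0 < v₀ i) (k : ℕ)
    (i : Fin n) : 0 < weights C v₀ k i := by
  obtain ⟨c, hc, h⟩ := exists_pos_le_weights hn hC hv₀
  exact hc.trans_le (h k i)

theorem one_le_kappa (hn : 0 < n) (hC : IsMixingMatrix 𝒢 C) (hv₀ : ∀ i, 0 < v₀ i)
    (hv₀n : ∑ i, v₀ i = n) :
    1 ≤ kappa C v₀ ∧ ∀ k i, (weights C v₀ k i)⁻¹ ≤ kappa C v₀ := by
  have hne : Nonempty (Fin n) := ⟨⟨0, hn⟩⟩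
  obtain ⟨c, hc, h⟩ := exists_pos_le_weights hn hC hv₀
  have hbdd : BddBelow (Set.range fun s : ℕ × Fin n => weights C v₀ s.1 s.2) :=
    ⟨c, by rintro _ ⟨s, rfl⟩; exact h s.1 s.2⟩
  have hinf : 0 < ⨅ s : ℕ × Fin n, weights C v₀ s.1 s.2 :=
    hc.trans_le (le_ciInf fun s => h s.1 s.2)
  have hle : ∀ k i, ⨅ s : ℕ × Fin n, weights C v₀ s.1 s.2 ≤ weights C v₀ k i :=
    fun k i => ciInf_le hbdd (k, i)
  refine ⟨?_, fun k i => inv_anti₀ hinf (hle k i)⟩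
  refine (one_le_inv₀ hinf).2 ?_
  -- The initial weights have mean one, so one of them is at most one.
  obtain ⟨i, -, hi⟩ := Finset.exists_le_of_sum_le (s := Finset.univ) (f := v₀) (g := fun _ => 1)
    Finset.univ_nonempty (by simp [hv₀n])
  exact (hle 0 i).trans hi

end Weights

/-! ### Construction of a Euclidean norm in which mixing contracts. -/

section MixingNorm

variable {n : ℕ} {𝒢 : Digraph (Fin n)} {C S : Matrix (Fin n) (Fin n) ℝ} {q : Fin n → ℝ}

theorem vecNorm_sq (S : Matrix (Fin n) (Fin n) ℝ) (x : Fin n → ℝ) :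
    vecNorm S x ^ 2 = S.mulVec x ⬝ᵥ S.mulVec x := by
  rw [vecNorm, EuclideanSpace.norm_sq_eq]
  simp [dotProduct, sq]

theorem vecNorm_nonneg (S : Matrix (Fin n) (Fin n) ℝ) (x : Fin n → ℝ) : 0 ≤ vecNorm S x :=
  norm_nonneg _

theorem vecNorm_add_le (S : Matrix (Fin n) (Fin n) ℝ) (x y : Fin n → ℝ) :
    vecNorm S (x + y) ≤ vecNorm S x + vecNorm S y := by
  unfold vecNorm
  rw [Matrix.mulVec_add, WithLp.toLp_add]
  exact norm_add_le _ _

theorem vecNorm_smul (S : Matrix (Fin n) (Fin n) ℝ) (c : ℝ) (x : Fin n → ℝ) :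
    vecNorm S (c • x) = |c| * vecNorm S x := by
  unfold vecNorm
  rw [Matrix.mulVec_smul, WithLp.toLp_smul, norm_smul, Real.norm_eq_abs]

theorem vecNorm_smul_matrix (S : Matrix (Fin n) (Fin n) ℝ) (c : ℝ) (x : Fin n → ℝ) :
    vecNorm (c • S) x = |c| * vecNorm S x := by
  unfold vecNorm
  rw [Matrix.smul_mulVec, WithLp.toLp_smul, norm_smul, Real.norm_eq_abs]

/-- Gelfand's formula for the complexified matrix, read back on real vectors. -/
theorem exists_pow_contraction (B : Matrix (Fin n) (Fin n) ℝ) {γ : ℝ} (hγ : 0 < γ)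
    (hB : spectralRadius ℂ (B.map (algebraMap ℝ ℂ)) < ENNReal.ofReal γ) :
    ∃ N : ℕ, 0 < N ∧ ∀ x, (B ^ N).mulVec x ⬝ᵥ (B ^ N).mulVec x ≤ γ ^ (2 * N) * (x ⬝ᵥ x) := by
  let _ := Matrix.instL2OpNormedRing (𝕜 := ℂ) (n := Fin n)
  let _ := Matrix.instL2OpNormedAlgebra (𝕜 := ℂ) (n := Fin n)
  set A := B.map (algebraMap ℝ ℂ) with hA
  have hlim := spectrum.pow_norm_pow_one_div_tendsto_nhds_spectralRadius A
  obtain ⟨N, hN, hN0⟩ :=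
    ((hlim.eventually_lt_const hB).and (Filter.eventually_gt_atTop 0)).exists
  refine ⟨N, hN0, fun x => ?_⟩
  have h1 : ‖A ^ N‖ ^ (1 / (N : ℝ)) < γ := (ENNReal.ofReal_lt_ofReal_iff hγ).1 hN
  have h2 : ‖A ^ N‖ ≤ γ ^ N := by
    have h3 : (‖A ^ N‖ ^ (1 / (N : ℝ))) ^ N ≤ γ ^ N := by gcongr
    rwa [one_div, Real.rpow_inv_natCast_pow (norm_nonneg _) hN0.ne'] at h3
  have h3 := Matrix.l2_opNorm_mulVec (A ^ N) (WithLp.toLp 2 ((algebraMap ℝ ℂ) ∘ x))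
  have h4 : ∀ y : Fin n → ℝ,
      ‖(WithLp.toLp 2 ((algebraMap ℝ ℂ) ∘ y) : EuclideanSpace ℂ (Fin n))‖ ^ 2 = y ⬝ᵥ y := by
    intro y
    rw [EuclideanSpace.norm_sq_eq]
    simp [dotProduct, sq]
  have h5 : (A ^ N).mulVec ((algebraMap ℝ ℂ) ∘ x) = (algebraMap ℝ ℂ) ∘ ((B ^ N).mulVec x) := by
    rw [hA, show (B.map (algebraMap ℝ ℂ)) ^ N = (B ^ N).map (algebraMap ℝ ℂ) from
      (Matrix.map_pow B (algebraMap ℝ ℂ) N).symm]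
    exact funext fun i => (RingHom.map_mulVec (algebraMap ℝ ℂ) (B ^ N) x i).symm
  rw [WithLp.ofLp_toLp, h5] at h3
  have h6 := h3.trans (mul_le_mul_of_nonneg_right h2 (norm_nonneg _))
  have h7 := pow_le_pow_left₀ (norm_nonneg _) h6 2
  rw [mul_pow, h4] at h7
  erw [h4] at h7
  rwa [← pow_mul, mul_comm N 2] at h7

/-- The quadratic form of a finite sum of weighted Gram matrices. -/
theorem exists_matrix_of_gram {ι : Type*} (s : Finset ι) (c : ι → ℝ) (hc : ∀ k, 0 ≤ c k)
    (M : ι → Matrix (Fin n) (Fin n) ℝ) :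
    ∃ S : Matrix (Fin n) (Fin n) ℝ, ∀ x,
      vecNorm S x ^ 2 = ∑ k ∈ s, c k * ((M k).mulVec x ⬝ᵥ (M k).mulVec x) := by
  have hP : (∑ k ∈ s, c k • ((M k).conjTranspose * M k)).PosSemidef :=
    Matrix.posSemidef_sum s fun k _ =>
      (Matrix.posSemidef_conjTranspose_mul_self (M k)).smul (hc k)
  open scoped MatrixOrder Matrix.Norms.L2Operator in
  obtain ⟨S, hS⟩ := CStarAlgebra.nonneg_iff_eq_star_mul_self.mp hP.nonneg
  refine ⟨S, fun x => ?_⟩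
  have key : ∀ T : Matrix (Fin n) (Fin n) ℝ,
      T.mulVec x ⬝ᵥ T.mulVec x = x ⬝ᵥ (T.conjTranspose * T).mulVec x := by
    intro T
    rw [← Matrix.mulVec_mulVec, Matrix.conjTranspose_eq_transpose_of_trivial,
      Matrix.dotProduct_mulVec x, Matrix.vecMul_transpose]
  rw [vecNorm_sq, key, ← Matrix.star_eq_conjTranspose, ← hS, Matrix.sum_mulVec, dotProduct_sum]
  refine Finset.sum_congr rfl fun k _ => ?_
  rw [key, Matrix.smul_mulVec, dotProduct_smul, smul_eq_mul]

theorem exists_scaling_of_isUnit (hS : IsUnit S) :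
    ∃ t δ : ℝ, 0 < t ∧ 1 ≤ δ ∧
      (∀ x, vecNorm (t • S) x ≤ ‖(WithLp.toLp 2 x : EuclideanSpace ℝ (Fin n))‖) ∧
      ∀ x, ‖(WithLp.toLp 2 x : EuclideanSpace ℝ (Fin n))‖ ≤ δ * vecNorm (t • S) x := by
  let _ := Matrix.instL2OpNormedRing (𝕜 := ℝ) (n := Fin n)
  have h1 : ∀ x, vecNorm S x ≤ ‖S‖ * ‖(WithLp.toLp 2 x : EuclideanSpace ℝ (Fin n))‖ :=
    fun x => Matrix.l2_opNorm_mulVec S (WithLp.toLp 2 x)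
  have h2 : ∀ x, ‖(WithLp.toLp 2 x : EuclideanSpace ℝ (Fin n))‖ ≤ ‖S⁻¹‖ * vecNorm S x := by
    intro x
    have h := Matrix.l2_opNorm_mulVec S⁻¹ (WithLp.toLp 2 (S.mulVec x))
    rwa [WithLp.ofLp_toLp, Matrix.mulVec_mulVec,
      Matrix.nonsing_inv_mul _ ((Matrix.isUnit_iff_isUnit_det S).1 hS), Matrix.one_mulVec] at h
  -- The summand `1` avoids a case distinction for a zero norm, which occurs when `n = 0`.
  have ht : 0 < 1 / (‖S‖ + 1) := by positivity
  refine ⟨1 / (‖S‖ + 1), max 1 (‖S⁻¹‖ * (‖S‖ + 1)), ht, le_max_left _ _, fun x => ?_, fun x => ?_⟩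
  · rw [vecNorm_smul_matrix, abs_of_pos ht, one_div, inv_mul_le_iff₀ (by positivity)]
    refine (h1 x).trans ?_
    gcongr
    linarith
  · rw [vecNorm_smul_matrix, abs_of_pos ht]
    have h0 := vecNorm_nonneg S x
    calc _ ≤ ‖S⁻¹‖ * vecNorm S x := h2 x
      _ = ‖S⁻¹‖ * (‖S‖ + 1) * (1 / (‖S‖ + 1) * vecNorm S x) := by field_simp
      _ ≤ _ := by
        gcongr
        exact le_max_right _ _

/-- The squared norm is a positive multiple of `Q₀ ((1 - R) x) + ‖R x‖²`, where `Q₀` is adapted to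
`B = C - R`. Splitting along the projection `R` makes `1 - R` nonexpansive, and since `R B = 0` and
`B` commutes with `1 - R`, the contraction of `Q₀` under `B` passes to the whole norm. -/
theorem exists_isMixingNorm (hn : 0 < n) (hC : IsMixingMatrix 𝒢 C) (hq : IsPerronVector C q)
    {ϑ : ℝ} (hϑ : ϑ < 1 - rho (C - rankOne q)) : ∃ S δ, IsMixingNorm C q ϑ S δ := by
  set R := rankOne q with hR
  set B := C - R with hB
  set γ := 1 - ϑ with hγ
  have hργ : rho B < γ := by linarith
  have hγ0 : 0 < γ := lt_of_le_of_lt ENNReal.toReal_nonneg hργ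
  have hne : spectralRadius ℂ (B.map (algebraMap ℝ ℂ)) ≠ ⊤ :=
    (spectralRadius_lt_one hn hC hq).ne_top
  have hsr : spectralRadius ℂ (B.map (algebraMap ℝ ℂ)) < ENNReal.ofReal γ := by
    rw [← ENNReal.ofReal_toReal hne]
    exact (ENNReal.ofReal_lt_ofReal_iff hγ0).2 hργ
  obtain ⟨N, hN0, hN⟩ := exists_pow_contraction B hγ0 hsr
  have hRR : R * R = R := rankOne_mul (hq.col_sum_rankOne hn)
  have hRB : R * B = 0 := by rw [hB, mul_sub, rankOne_mul hC.col_sum, hRR, sub_self]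
  have hBR : B * R = 0 := by rw [hB, sub_mul, mul_rankOne hq, hRR, sub_self]
  have hPB : (1 - R) * B = B * (1 - R) := by
    rw [sub_mul 1 R B, mul_sub B 1 R, hRB, hBR, one_mul, mul_one]
  have hPP : (1 - R) * (1 - R) = 1 - R := by
    rw [mul_sub, mul_one, sub_mul 1 R R, hRR, one_mul, sub_self, sub_zero]
  have hRP : R * (1 - R) = 0 := by rw [mul_sub, hRR, mul_one, sub_self]
  let Q₀ : (Fin n → ℝ) → ℝ := fun y =>
    ∑ k ∈ Finset.range N, (γ ^ (2 * k))⁻¹ * ((B ^ k).mulVec y ⬝ᵥ (B ^ k).mulVec y)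
  have hQ₀ : ∀ y, y ⬝ᵥ y ≤ Q₀ y := by
    intro y
    have := Finset.single_le_sum (f := fun k =>
      (γ ^ (2 * k))⁻¹ * ((B ^ k).mulVec y ⬝ᵥ (B ^ k).mulVec y)) (fun k _ => by
        have := dotProduct_self_star_nonneg ((B ^ k).mulVec y)
        rw [star_trivial] at this
        positivity) (Finset.mem_range.2 hN0)
    simpa using this
  -- Applying `B` shifts the sum by one index and produces `γ ^ 2`. The new last term is at most the
  -- lost first one, because `B ^ N` contracts by `γ ^ N`.
  have hQ₀B : ∀ y, Q₀ (B.mulVec y) ≤ γ ^ 2 * Q₀ y := by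
    intro y
    let F : ℕ → ℝ := fun k => (γ ^ (2 * k))⁻¹ * ((B ^ k).mulVec y ⬝ᵥ (B ^ k).mulVec y)
    have h1 : Q₀ (B.mulVec y) = γ ^ 2 * ∑ k ∈ Finset.range N, F (k + 1) := by
      rw [Finset.mul_sum]
      refine Finset.sum_congr rfl fun k _ => ?_
      simp only [F]
      rw [Matrix.mulVec_mulVec, ← pow_succ, mul_add, pow_add γ]
      field_simp
    have h2 : ∑ k ∈ Finset.range N, F (k + 1) + F 0 = ∑ k ∈ Finset.range N, F k + F N := by
      rw [← Finset.sum_range_succ', ← Finset.sum_range_succ]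
    have h3 : F N ≤ F 0 := by
      simp only [F]
      rw [inv_mul_le_iff₀ (by positivity)]
      simpa using hN y
    rw [h1]
    refine mul_le_mul_of_nonneg_left ?_ (by positivity)
    simp only [Q₀]
    linarith
  -- The indices below `N` carry the terms of `Q₀`; the extra index `N` carries `‖R x‖²`.
  obtain ⟨S, hS⟩ := exists_matrix_of_gram (Finset.range (N + 1))
    (fun k => if k < N then (γ ^ (2 * k))⁻¹ else 1) (fun k => by split_ifs <;> positivity)
    (fun k => if k < N then B ^ k * (1 - R) else R)
  have hS' : ∀ x, vecNorm S x ^ 2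
      = Q₀ ((1 - R).mulVec x) + R.mulVec x ⬝ᵥ R.mulVec x := by
    intro x
    rw [hS, Finset.sum_range_succ]
    simp only [lt_irrefl, if_false, one_mul]
    congr 1
    refine Finset.sum_congr rfl fun k hk => ?_
    rw [if_pos (Finset.mem_range.1 hk), if_pos (Finset.mem_range.1 hk), Matrix.mulVec_mulVec]
  have hdot : ∀ y : Fin n → ℝ, 0 ≤ y ⬝ᵥ y := fun y => by
    have := dotProduct_self_star_nonneg y
    rwa [star_trivial] at this
  have hunit : IsUnit S := by
    rw [← Matrix.mulVec_injective_iff_isUnit]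
    rw [← Matrix.coe_mulVecLin, ← LinearMap.ker_eq_bot, LinearMap.ker_eq_bot']
    intro x hx
    have hx' : S.mulVec x = 0 := hx
    have h1 := hS' x
    rw [vecNorm_sq, hx', dotProduct_zero] at h1
    have h2 := hQ₀ ((1 - R).mulVec x)
    have h3 := hdot ((1 - R).mulVec x)
    have h4 := hdot (R.mulVec x)
    have h5 : (1 - R).mulVec x = 0 := dotProduct_self_eq_zero.1 (by linarith)
    have h6 : R.mulVec x = 0 := dotProduct_self_eq_zero.1 (by linarith)
    rwa [Matrix.sub_mulVec, Matrix.one_mulVec, h6, sub_zero] at h5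
  obtain ⟨t, δ, ht, hδ, hle, hge⟩ := exists_scaling_of_isUnit hunit
  refine ⟨t • S, δ, ?_, hδ, hle, hge, fun x => ?_, fun x => ?_⟩
  · rw [Matrix.isUnit_iff_isUnit_det, Matrix.det_smul]
    exact (ht.ne'.isUnit.pow _).mul ((Matrix.isUnit_iff_isUnit_det S).1 hunit)
  · rw [vecNorm_smul_matrix, vecNorm_smul_matrix, mul_left_comm]
    refine mul_le_mul_of_nonneg_left ?_ (abs_nonneg t)
    refine (sq_le_sq₀ (vecNorm_nonneg _ _) (mul_nonneg hγ0.le (vecNorm_nonneg _ _))).1 ?_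
    rw [mul_pow, hS', hS', Matrix.mulVec_mulVec, Matrix.mulVec_mulVec, hRB, hPB,
      ← Matrix.mulVec_mulVec, Matrix.zero_mulVec, dotProduct_zero, add_zero]
    have h1 := hQ₀B ((1 - R).mulVec x)
    have h2 := hdot (R.mulVec x)
    have h3 : 0 ≤ γ ^ 2 * (R.mulVec x ⬝ᵥ R.mulVec x) := by positivity
    linarith
  · rw [vecNorm_smul_matrix, vecNorm_smul_matrix]
    refine mul_le_mul_of_nonneg_left ?_ (abs_nonneg t)
    refine (sq_le_sq₀ (vecNorm_nonneg _ _) (vecNorm_nonneg _ _)).1 ?_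
    rw [hS', hS', Matrix.mulVec_mulVec, Matrix.mulVec_mulVec, hRP, hPP, Matrix.zero_mulVec,
      dotProduct_zero]
    linarith [hdot (R.mulVec x)]

end MixingNorm

/-! ### Means, consensus errors and norms of stacked variables. -/

section Stacks

variable {n p : ℕ} {C S : Matrix (Fin n) (Fin n) ℝ} {q : Fin n → ℝ} {ϑ δ : ℝ}

theorem mix_add (A : Matrix (Fin n) (Fin n) ℝ) (X Y : Stack n p) :
    mix A (X + Y) = mix A X + mix A Y := by
  funext i; simp [mix, Finset.sum_add_distrib]

theorem mix_sub (A : Matrix (Fin n) (Fin n) ℝ) (X Y : Stack n p) :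
    mix A (X - Y) = mix A X - mix A Y := by
  funext i; simp [mix, smul_sub, Finset.sum_sub_distrib]

theorem mix_smul (A : Matrix (Fin n) (Fin n) ℝ) (c : ℝ) (X : Stack n p) :
    mix A (c • X) = c • mix A X := by
  funext i; simp [mix, Finset.smul_sum, smul_comm c]

theorem mix_mix (A B : Matrix (Fin n) (Fin n) ℝ) (X : Stack n p) :
    mix A (mix B X) = mix (A * B) X := by
  funext i
  simp only [mix, Matrix.mul_apply, Finset.smul_sum, Finset.sum_smul, smul_smul]
  exact Finset.sum_comm

theorem rowMean_add (X Y : Stack n p) : rowMean (X + Y) = rowMean X + rowMean Y := by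
  simp [rowMean, Finset.sum_add_distrib]

theorem rowMean_sub (X Y : Stack n p) : rowMean (X - Y) = rowMean X - rowMean Y := by
  simp [rowMean, Finset.sum_sub_distrib, smul_sub]

theorem rowMean_smul (c : ℝ) (X : Stack n p) : rowMean (c • X) = c • rowMean X := by
  simp [rowMean, ← Finset.smul_sum, smul_comm c]

theorem rowMean_mix (hC : ∀ j, ∑ i, C i j = 1) (X : Stack n p) :
    rowMean (mix C X) = rowMean X := by
  simp only [rowMean, mix]
  rw [Finset.sum_comm]
  congr 1
  exact Finset.sum_congr rfl fun j _ => by rw [← Finset.sum_smul, hC, one_smul]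

theorem norm_rowMean_sq_le (hn : 0 < n) (X : Stack n p) :
    ‖rowMean X‖ ^ 2 ≤ (1 / (n : ℝ)) * ∑ i, ‖X i‖ ^ 2 := by
  have h1 : ‖rowMean X‖ ≤ (1 / (n : ℝ)) * ∑ i, ‖X i‖ := by
    rw [rowMean, norm_smul, Real.norm_of_nonneg (by positivity)]
    gcongr
    exact norm_sum_le _ _
  have h2 : (∑ i, ‖X i‖) ^ 2 ≤ n * ∑ i, ‖X i‖ ^ 2 := by
    simpa using sq_sum_le_card_mul_sum_sq (s := Finset.univ) (f := fun i => ‖X i‖)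
  calc ‖rowMean X‖ ^ 2 ≤ ((1 / (n : ℝ)) * ∑ i, ‖X i‖) ^ 2 := by gcongr
    _ = (1 / (n : ℝ)) ^ 2 * (∑ i, ‖X i‖) ^ 2 := by ring
    _ ≤ (1 / (n : ℝ)) ^ 2 * (n * ∑ i, ‖X i‖ ^ 2) := by gcongr
    _ = _ := by field_simp

theorem consensusError_apply (X : Stack n p) (i : Fin n) :
    consensusError q X i = X i - q i • rowMean X := by
  simp only [consensusError, mix, rowMean, rankOne, Matrix.sub_apply, Matrix.one_apply,
    Matrix.of_apply, sub_smul, Finset.sum_sub_distrib, ite_smul, one_smul, zero_smul,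
    Finset.sum_ite_eq, Finset.mem_univ, if_true, Finset.smul_sum, smul_smul]
  simp only [div_eq_mul_inv, one_mul]

theorem consensusError_mix {𝒢 : Digraph (Fin n)} (hn : 0 < n) (hC : IsMixingMatrix 𝒢 C)
    (hq : IsPerronVector C q) (X : Stack n p) :
    consensusError q (mix C X) = mix (C - rankOne q) (consensusError q X) := by
  rw [consensusError, consensusError, mix_mix, mix_mix, one_sub_rankOne_mul hn hC hq]

theorem matNorm_sq (S : Matrix (Fin n) (Fin n) ℝ) (A : Stack n p) :
    matNorm S A ^ 2 = ∑ c, vecNorm S (fun i => A i c) ^ 2 := by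
  rw [matNorm, Real.sq_sqrt (by positivity)]

theorem column_mix (A : Matrix (Fin n) (Fin n) ℝ) (X : Stack n p) (c : Fin p) :
    (fun i => mix A X i c) = A.mulVec fun i => X i c := by
  funext i
  simp [mix, Matrix.mulVec, dotProduct]

theorem sum_norm_sq_eq (A : Stack n p) :
    ∑ i, ‖A i‖ ^ 2 = ∑ c, ‖(WithLp.toLp 2 fun i => A i c : EuclideanSpace ℝ (Fin n))‖ ^ 2 := by
  simp only [EuclideanSpace.norm_sq_eq]
  exact Finset.sum_comm

theorem matNorm_sq_smul (c : ℝ) (A : Stack n p) :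
    matNorm S (c • A) ^ 2 = c ^ 2 * matNorm S A ^ 2 := by
  rw [matNorm_sq, matNorm_sq, Finset.mul_sum]
  refine Finset.sum_congr rfl fun j _ => ?_
  rw [show (fun i => (c • A) i j) = c • fun i => A i j from rfl, vecNorm_smul, mul_pow, sq_abs]

/-- Convexity of the square, with `b` written as `ϑ (b / ϑ)`. -/
theorem sq_add_le_div {ϑ : ℝ} (hϑ : 0 < ϑ) (hϑ1 : ϑ < 1) (a b : ℝ) :
    ((1 - ϑ) * a + b) ^ 2 ≤ (1 - ϑ) * a ^ 2 + 1 / ϑ * b ^ 2 := by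
  have h : (1 - ϑ) * a ^ 2 + 1 / ϑ * b ^ 2 - ((1 - ϑ) * a + b) ^ 2
      = (1 - ϑ) / ϑ * (ϑ * a - b) ^ 2 := by
    field_simp; ring
  have : 0 ≤ (1 - ϑ) / ϑ * (ϑ * a - b) ^ 2 := by
    have : 0 ≤ 1 - ϑ := by linarith
    positivity
  linarith

theorem matNorm_sq_add_le_two (A B : Stack n p) :
    matNorm S (A + B) ^ 2 ≤ 2 * matNorm S A ^ 2 + 2 * matNorm S B ^ 2 := by
  rw [matNorm_sq, matNorm_sq, matNorm_sq, Finset.mul_sum, Finset.mul_sum,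
    ← Finset.sum_add_distrib]
  refine Finset.sum_le_sum fun j _ => ?_
  have h := pow_le_pow_left₀ (vecNorm_nonneg S _)
    (vecNorm_add_le S (fun i => A i j) fun i => B i j) 2
  exact h.trans (add_sq_le.trans_eq (by ring))

namespace IsMixingNorm

variable (hS : IsMixingNorm C q ϑ S δ)
include hS

theorem matNorm_sq_le (A : Stack n p) : matNorm S A ^ 2 ≤ ∑ i, ‖A i‖ ^ 2 := by
  rw [matNorm_sq, sum_norm_sq_eq]
  exact Finset.sum_le_sum fun c _ => pow_le_pow_left₀ (vecNorm_nonneg _ _) (hS.le_euclidean _) 2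

theorem sum_sq_le (A : Stack n p) : ∑ i, ‖A i‖ ^ 2 ≤ δ ^ 2 * matNorm S A ^ 2 := by
  rw [matNorm_sq, sum_norm_sq_eq, Finset.mul_sum]
  refine Finset.sum_le_sum fun c _ => ?_
  rw [← mul_pow]
  exact pow_le_pow_left₀ (norm_nonneg _) (hS.euclidean_le _) 2

theorem matNorm_consensusError_sq_le (A : Stack n p) :
    matNorm S (consensusError q A) ^ 2 ≤ matNorm S A ^ 2 := by
  rw [matNorm_sq, matNorm_sq]
  refine Finset.sum_le_sum fun c _ => ?_
  rw [consensusError, column_mix]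
  exact pow_le_pow_left₀ (vecNorm_nonneg _ _) (hS.projection _) 2

/-- A perturbed contraction, in squared form. -/
theorem matNorm_mix_add_sq_le (hϑ : 0 < ϑ) (hϑ1 : ϑ < 1) (A D : Stack n p) :
    matNorm S (mix (C - rankOne q) A + D) ^ 2
      ≤ (1 - ϑ) * matNorm S A ^ 2 + 1 / ϑ * matNorm S D ^ 2 := by
  rw [matNorm_sq, matNorm_sq, matNorm_sq, Finset.mul_sum, Finset.mul_sum,
    ← Finset.sum_add_distrib]
  refine Finset.sum_le_sum fun c _ => ?_
  refine le_trans (pow_le_pow_left₀ (vecNorm_nonneg _ _) ?_ 2) (sq_add_le_div hϑ hϑ1 _ _)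
  refine (vecNorm_add_le S (fun i => mix (C - rankOne q) A i c) fun i => D i c).trans ?_
  rw [column_mix]
  have := hS.contraction fun i => A i c
  linarith

theorem matNorm_mix_sq_le (hϑ : 0 < ϑ) (A : Stack n p) :
    matNorm S (mix (C - rankOne q) A) ^ 2 ≤ matNorm S A ^ 2 := by
  rw [matNorm_sq, matNorm_sq]
  refine Finset.sum_le_sum fun c _ => ?_
  rw [column_mix]
  refine pow_le_pow_left₀ (vecNorm_nonneg _ _) ((hS.contraction _).trans ?_) 2
  exact mul_le_of_le_one_left (vecNorm_nonneg _ _) (by linarith)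

/-- The difference of the weights and the Perron vector is zero-sum, so `C` acts on it as the
contraction `C - rankOne q`. -/
theorem vecNorm_weights_sub_le {𝒢 : Digraph (Fin n)} (hC : IsMixingMatrix 𝒢 C)
    (hq : IsPerronVector C q) (hϑ1 : ϑ < 1) {v₀ : Fin n → ℝ} (hv₀n : ∑ i, v₀ i = n) (k : ℕ) :
    vecNorm S (weights C v₀ k - q) ≤ (1 - ϑ) ^ k * vecNorm S (v₀ - q) := by
  induction k with
  | zero => simp [weights]
  | succ k ih =>
    have h : weights C v₀ (k + 1) - q = (C - rankOne q).mulVec (weights C v₀ k - q) := by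
      have h0 : (rankOne q).mulVec (weights C v₀ k - q) = 0 := by
        funext i
        rw [rankOne_mulVec]
        simp [Finset.sum_sub_distrib, sum_weights hC.col_sum hv₀n, hq.sum_eq]
      rw [Matrix.sub_mulVec, h0, sub_zero, Matrix.mulVec_sub, hq.eigen, weights]
    rw [h, pow_succ', mul_assoc]
    refine (hS.contraction _).trans ?_
    have : 0 ≤ 1 - ϑ := by linarith
    gcongr

/-- The rows of `V⁻¹ X` are close to the mean of the rows of `X` when the consensus error of `X`
is small and the weights `v` are close to the Perron vector. -/
theorem dispersion_le (hn : 0 < n) {v : Fin n → ℝ} (hv : ∀ i, 0 < v i) {κ r : ℝ}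
    (hκ : ∀ i, (v i)⁻¹ ≤ κ) (hr : vecNorm S (v - q) ≤ r) (X : Stack n p) :
    n * dispersion (fun i => (v i)⁻¹ • X i) (rowMean X) ≤
      2 * δ ^ 2 * κ ^ 2 * (matNorm S (consensusError q X) ^ 2 + r ^ 2 * ‖rowMean X‖ ^ 2) := by
  have h1 : ∀ i, ‖(v i)⁻¹ • X i - rowMean X‖ ^ 2 ≤
      κ ^ 2 * (2 * ‖consensusError q X i‖ ^ 2 + 2 * ((v - q) i ^ 2 * ‖rowMean X‖ ^ 2)) := by
    intro i
    -- Since `X i` is its consensus error plus `q i` times the mean, a vanishing consensus error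
    -- still leaves the mean multiplied by `q i - v i`.
    have e : (v i)⁻¹ • X i - rowMean X
        = (v i)⁻¹ • (consensusError q X i + (q i - v i) • rowMean X) := by
      rw [consensusError_apply, sub_smul, sub_add_sub_cancel, smul_sub, smul_smul,
        inv_mul_cancel₀ (hv i).ne', one_smul]
    have h0 : 0 ≤ (v i)⁻¹ := (inv_pos.2 (hv i)).le
    rw [e, norm_smul, mul_pow, Real.norm_of_nonneg h0]
    have h2 := norm_add_sq_le_two (consensusError q X i) ((q i - v i) • rowMean X)
    rw [norm_smul, mul_pow, Real.norm_eq_abs, sq_abs] at h2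
    rw [Pi.sub_apply, show (v i - q i) ^ 2 = (q i - v i) ^ 2 by ring]
    gcongr
    exact hκ i
  have h2 : ∑ i, (v - q) i ^ 2 ≤ δ ^ 2 * r ^ 2 := by
    have h := hS.euclidean_le (v - q)
    have h3 : ‖(WithLp.toLp 2 (v - q) : EuclideanSpace ℝ (Fin n))‖ ≤ δ * r :=
      h.trans (mul_le_mul_of_nonneg_left hr (by linarith [hS.one_le]))
    have h4 := pow_le_pow_left₀ (norm_nonneg _) h3 2
    rw [EuclideanSpace.norm_sq_eq, mul_pow] at h4
    simpa using h4
  have h3 := hS.sum_sq_le (consensusError q X)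
  unfold dispersion
  rw [← mul_assoc, mul_one_div_cancel (by positivity), one_mul]
  refine (Finset.sum_le_sum fun i _ => h1 i).trans ?_
  rw [← Finset.mul_sum, Finset.sum_add_distrib, ← Finset.mul_sum, ← Finset.mul_sum,
    ← Finset.sum_mul]
  calc _ ≤ κ ^ 2 * (2 * (δ ^ 2 * matNorm S (consensusError q X) ^ 2)
        + 2 * (δ ^ 2 * r ^ 2 * ‖rowMean X‖ ^ 2)) := by gcongr
    _ = _ := by ring

end IsMixingNorm

end Stacks

/-! ### The scalar Lyapunov argument. -/

section Lyapunov

/-- The weight of the gradient tracking error in the Lyapunov function. -/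
def trackingWeight (l ϑ : ℝ) : ℝ := l * (64 / ϑ ^ 3 + 7 / (2 * ϑ ^ 5))

/-- The Lyapunov function; `Ψ` is the potential of the accelerated method, `a, e, t` are the
consensus errors of the variables, their momentum and the trackers, `P, Q` are the damped norms of
the means, and `m` is a mean squared difference of gradients. -/
def lyapunov (l ϑ w r Ψ a e t m P Q : ℝ) : ℝ :=
  Ψ + 24 * l / ϑ * a + 52 * l / ϑ ^ 3 * e + trackingWeight l ϑ * t - 2 * r * m
    + w ^ 2 * (24 * l / ϑ * P + 52 * l / ϑ ^ 3 * Q)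

variable {l ϑ w r β : ℝ}

/-- The contraction yields `24 l a`: at most `3/2` goes to the rate `β`, and `45/2` is left for the
dispersion terms, of which `22` are needed. -/
theorem damped_first (hl : 0 ≤ l) (hϑ : 0 < ϑ) (hβ : β ≤ ϑ / 16) {a : ℝ}
    (ha : 0 ≤ a) :
    24 * l / ϑ * ((1 - ϑ) * a) + 45 / 2 * l * a ≤ (1 - β) * (24 * l / ϑ * a) := by
  have h : 24 * l / ϑ * (β * a) ≤ 24 * l / ϑ * (ϑ / 16 * a) := by gcongr
  have e : 24 * l / ϑ * (ϑ / 16 * a) = 3 / 2 * l * a := by field_simp; ring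
  have e2 : 24 * l / ϑ * (ϑ * a) = 24 * l * a := by field_simp
  linarith

/-- The budget in units of `l / ϑ ^ 2 * e` is `48 + 13/4 ≤ 52`: the input of the momentum to `X`,
and the rate. -/
theorem damped_second (hl : 0 ≤ l) (hϑ : 0 < ϑ) (hβ : β ≤ ϑ / 16) {e : ℝ}
    (he : 0 ≤ e) :
    52 * l / ϑ ^ 3 * ((1 - ϑ) * e) + 24 * l / ϑ * (1 / ϑ * (2 * e))
      ≤ (1 - β) * (52 * l / ϑ ^ 3 * e) := by
  have h : 52 * l / ϑ ^ 3 * (β * e) ≤ 52 * l / ϑ ^ 3 * (ϑ / 16 * e) := by gcongr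
  have e1 : 52 * l / ϑ ^ 3 * (ϑ / 16 * e) = 13 / 4 * (l / ϑ ^ 2 * e) := by field_simp; ring
  have e2 : 52 * l / ϑ ^ 3 * (ϑ * e) = 52 * (l / ϑ ^ 2 * e) := by field_simp
  have e3 : 24 * l / ϑ * (1 / ϑ * (2 * e)) = 48 * (l / ϑ ^ 2 * e) := by field_simp; ring
  have : 0 ≤ l / ϑ ^ 2 * e := by positivity
  linarith

/-- The two parts of the tracking weight pay for the two inputs of the trackers: `60 + 4 = 64` for
`X`, and `13/4 + 7/32 ≤ 7/2` for the momentum. -/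
theorem damped_third (hl : 0 ≤ l) (hϑ : 0 < ϑ) (hβ : β ≤ ϑ / 16) {t : ℝ}
    (ht : 0 ≤ t) :
    trackingWeight l ϑ * ((1 - ϑ) * t) + 24 * l / ϑ * (1 / ϑ * (5 / 2 * t))
      + 52 * l / ϑ ^ 3 * (1 / ϑ * (1 / 16 * t)) ≤ (1 - β) * (trackingWeight l ϑ * t) := by
  unfold trackingWeight
  have h : l * (64 / ϑ ^ 3 + 7 / (2 * ϑ ^ 5)) * (β * t)
      ≤ l * (64 / ϑ ^ 3 + 7 / (2 * ϑ ^ 5)) * (ϑ / 16 * t) := by gcongr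
  have e1 : l * (64 / ϑ ^ 3 + 7 / (2 * ϑ ^ 5)) * (ϑ * t)
      = 64 * (l / ϑ ^ 2 * t) + 7 / 2 * (l / ϑ ^ 4 * t) := by field_simp
  have e2 : 24 * l / ϑ * (1 / ϑ * (5 / 2 * t)) = 60 * (l / ϑ ^ 2 * t) := by field_simp; ring
  have e3 : 52 * l / ϑ ^ 3 * (1 / ϑ * (1 / 16 * t)) = 13 / 4 * (l / ϑ ^ 4 * t) := by
    field_simp; ring
  have : 0 ≤ l / ϑ ^ 2 * t := by positivity
  have : 0 ≤ l / ϑ ^ 4 * t := by positivity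
  linarith

theorem le_trackingWeight (hl : 0 ≤ l) (hϑ : 0 < ϑ) (hϑ1 : ϑ < 1) : 64 * l ≤ trackingWeight l ϑ := by
  unfold trackingWeight
  have h1 : 64 ≤ 64 / ϑ ^ 3 := by
    rw [le_div_iff₀ (by positivity)]
    have : ϑ ^ 3 ≤ 1 := pow_le_one₀ hϑ.le hϑ1.le
    linarith
  have h2 : 0 ≤ 7 / (2 * ϑ ^ 5) := by positivity
  calc 64 * l = l * 64 := mul_comm _ _
    _ ≤ _ := by gcongr; linarith

/-- The value of `r` makes the term `2 r m'` from the tracker recursion cancel against the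
subtracted term of the new Lyapunov function. The surplus `5 η G` splits into `1/2` for the trackers
and `9/2` for the damped means. -/
theorem lyapunov_step {L N η : ℝ} (hl : 0 ≤ l) (hϑ : 0 < ϑ) (hϑ1 : ϑ < 1) (hβ0 : 0 < β)
    (hβ : β ≤ ϑ / 16) (hL : 0 < L) (hη : 0 < η) (hLη : L * η ≤ 1 / 2)
    (hN : 0 ≤ N) (hr : r = trackingWeight l ϑ * η ^ 2 * N / ϑ) (hrL : 4 * r * L ≤ 1)
    (hw : 15 * l * w ^ 2 * η ≤ ϑ ^ 4)
    {Ψ a e t m P Q G D Ψ' a' e' t' m' P' Q' : ℝ}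
    (ha : 0 ≤ a) (he : 0 ≤ e) (ht : 0 ≤ t) (hm : 0 ≤ m) (hP : 0 ≤ P) (hQ : 0 ≤ Q)
    (hG : 0 ≤ G) (hD : 0 ≤ D)
    (hΨ' : Ψ' + 5 * η * G + 3 / (2 * L) * m ≤ (1 - β) * Ψ + 21 * L * D)
    (hDa : L * D ≤ l * (a + w ^ 2 * P))
    (ht' : t' ≤ (1 - ϑ) * t
      + 1 / ϑ * (η ^ 2 * (N * (2 * m' + 2 * m + 4 * L ^ 2 * (η ^ 2 * G) + 4 * L ^ 2 * D))))
    (he' : e' ≤ (1 - ϑ) * e + 1 / ϑ * (1 / 16 * t))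
    (ha' : a' ≤ (1 - ϑ) * a + 1 / ϑ * (2 * e + 5 / 2 * t))
    (hQ' : Q' ≤ (1 - ϑ) * Q + 1 / ϑ * (1 / 16 * (η ^ 2 * G)))
    (hP' : P' ≤ (1 - ϑ) * P + 1 / ϑ * (2 * Q + 5 / 2 * (η ^ 2 * G))) :
    lyapunov l ϑ w r Ψ' a' e' t' m' P' Q' ≤ (1 - β) * lyapunov l ϑ w r Ψ a e t m P Q := by
  have hT : 0 ≤ trackingWeight l ϑ := le_trans (by positivity) (le_trackingWeight hl hϑ hϑ1)
  have hr0 : 0 ≤ r := by rw [hr]; positivity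
  have hlw : 0 ≤ l * w ^ 2 := by positivity
  have a1 := damped_first hl hϑ hβ ha
  have a2 := damped_second hl hϑ hβ he
  have a3 := damped_third hl hϑ hβ ht
  have a4 := damped_first hlw hϑ hβ hP
  have a5 := damped_second hlw hϑ hβ hQ
  have b1 : 24 * l / ϑ * a' ≤ 24 * l / ϑ * ((1 - ϑ) * a + 1 / ϑ * (2 * e + 5 / 2 * t)) := by gcongr
  have b2 : 52 * l / ϑ ^ 3 * e' ≤ 52 * l / ϑ ^ 3 * ((1 - ϑ) * e + 1 / ϑ * (1 / 16 * t)) := by gcongr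
  have b3 : trackingWeight l ϑ * t' ≤ trackingWeight l ϑ * ((1 - ϑ) * t)
      + r * (2 * m' + 2 * m + 4 * L ^ 2 * (η ^ 2 * G) + 4 * L ^ 2 * D) := by
    refine (mul_le_mul_of_nonneg_left ht' hT).trans_eq ?_
    rw [hr]; ring
  have b4 : 24 * (l * w ^ 2) / ϑ * P' ≤ 24 * (l * w ^ 2) / ϑ *
      ((1 - ϑ) * P + 1 / ϑ * (2 * Q + 5 / 2 * (η ^ 2 * G))) := by gcongr
  have b5 : 52 * (l * w ^ 2) / ϑ ^ 3 * Q' ≤ 52 * (l * w ^ 2) / ϑ ^ 3 *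
      ((1 - ϑ) * Q + 1 / ϑ * (1 / 16 * (η ^ 2 * G))) := by gcongr
  have c1 : r * (4 * L ^ 2 * D) ≤ L * D := by
    calc r * (4 * L ^ 2 * D) = 4 * r * L * (L * D) := by ring
      _ ≤ 1 * (L * D) := by gcongr
      _ = _ := one_mul _
  have c2 : r * (4 * L ^ 2 * (η ^ 2 * G)) ≤ 1 / 2 * (η * G) := by
    calc r * (4 * L ^ 2 * (η ^ 2 * G)) = 4 * r * L * (L * η * (η * G)) := by ring
      _ ≤ 1 * (1 / 2 * (η * G)) := by gcongr
      _ = _ := one_mul _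
  -- Twice `r m` comes from the tracker recursion, and at most twice more from the negative term of
  -- the old Lyapunov function.
  have c3 : 4 * r * m ≤ 3 / (2 * L) * m := by
    have : 4 * r ≤ 1 / L := by rw [le_div_iff₀ hL]; exact hrL
    have h2 : 3 / (2 * L) * m = 3 / 2 * (1 / L * m) := by field_simp
    have h3 : 0 ≤ 1 / L * m := by positivity
    have h4 : 4 * r * m ≤ 1 / L * m := by gcongr
    linarith
  have c4 : 24 * (l * w ^ 2) / ϑ * (1 / ϑ * (5 / 2 * (η ^ 2 * G)))
      + 52 * (l * w ^ 2) / ϑ ^ 3 * (1 / ϑ * (1 / 16 * (η ^ 2 * G))) ≤ 9 / 2 * (η * G) := by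
    have h1 : 24 * (l * w ^ 2) / ϑ * (1 / ϑ * (5 / 2 * (η ^ 2 * G)))
      + 52 * (l * w ^ 2) / ϑ ^ 3 * (1 / ϑ * (1 / 16 * (η ^ 2 * G)))
      = (60 * ϑ ^ 2 + 13 / 4) * (l * w ^ 2 * η / ϑ ^ 4) * (η * G) := by field_simp; ring
    have h2 : l * w ^ 2 * η / ϑ ^ 4 ≤ 1 / 15 := by
      rw [div_le_iff₀ (by positivity)]; linarith
    have h3 : ϑ ^ 2 ≤ 1 := pow_le_one₀ hϑ.le hϑ1.le
    have h4 : 0 ≤ l * w ^ 2 * η / ϑ ^ 4 := by positivity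
    rw [h1]
    gcongr
    calc (60 * ϑ ^ 2 + 13 / 4) * (l * w ^ 2 * η / ϑ ^ 4)
        ≤ (60 * 1 + 13 / 4) * (1 / 15) := by gcongr
      _ ≤ 9 / 2 := by norm_num
  have c5 : 0 ≤ β * (r * m) := by positivity
  have c6 : 0 ≤ l * a := by positivity
  have c7 : 0 ≤ l * w ^ 2 * P := by positivity
  have e1 : ∀ ψ a e t m P Q : ℝ, lyapunov l ϑ w r ψ a e t m P Q = ψ + 24 * l / ϑ * a
      + 52 * l / ϑ ^ 3 * e + trackingWeight l ϑ * t - 2 * (r * m)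
      + 24 * (l * w ^ 2) / ϑ * P + 52 * (l * w ^ 2) / ϑ ^ 3 * Q := by
    intros; unfold lyapunov; ring
  rw [e1, e1]
  simp only [mul_add, mul_sub] at *
  linarith

/-- The accelerated inequality bounds the new gap and also leaves a share of `η G` and `m`. These
absorb the gradient part of the output's dispersion and the negative term of the Lyapunov function.
-/
theorem output_le_lyapunov {L η : ℝ} (hl : 0 ≤ l) (hϑ : 0 < ϑ) (hϑ1 : ϑ < 1)
    (hβ0 : 0 < β) (hβ : β ≤ 1 / 16) (hL : 0 < L) (hη : 0 < η) (hrL : 4 * r * L ≤ 1)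
    (hw : 15 * l * w ^ 2 * η ≤ ϑ ^ 4)
    {Ψ a e t m P Q G D φ D' : ℝ}
    (ha : 0 ≤ a) (he : 0 ≤ e) (ht : 0 ≤ t) (hm : 0 ≤ m) (hP : 0 ≤ P) (hQ : 0 ≤ Q)
    (hG : 0 ≤ G) (hΨ : 0 ≤ Ψ)
    (hφ : 12 * (1 - β) * φ + 5 * η * G + 3 / (2 * L) * m ≤ (1 - β) * Ψ + 21 * L * D)
    (hDa : L * D ≤ l * (a + w ^ 2 * P))
    (hD' : L * D' ≤ l * (2 * a + 2 * t + w ^ 2 * (2 * P + 2 * (η ^ 2 * G)))) :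
    2 * φ + L * D' ≤ 1 / 4 * lyapunov l ϑ w r Ψ a e t m P Q := by
  have hlw : 0 ≤ l * w ^ 2 := by positivity
  have hβ1 : 0 < 1 - β := by linarith
  have hX : 0 ≤ l * (a + w ^ 2 * P) := by positivity
  -- Division by `6 (1 - β)`; here `56/15 = 21/6 · 16/15`, from `1 - β ≥ 15/16`.
  have h1 : 2 * φ + 1 / 2 * (η * G) + 1 / (4 * L) * m ≤ 1 / 6 * Ψ + 56 / 15 * (l * (a + w ^ 2 * P)) := by
    refine le_of_mul_le_mul_left ?_ (by linarith : 0 < 6 * (1 - β))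
    have k1 : 0 ≤ β * (η * G) := by positivity
    have k2 : 0 ≤ β * (1 / (4 * L) * m) := by positivity
    have k3 : 3 / (2 * L) * m = 6 * (1 / (4 * L) * m) := by field_simp; ring
    have k5 : 15 / 16 * (l * (a + w ^ 2 * P)) ≤ (1 - β) * (l * (a + w ^ 2 * P)) := by
      gcongr; linarith
    have k6 : 0 ≤ η * G := by positivity
    linarith
  have h2 : 2 * (l * w ^ 2 * (η ^ 2 * G)) ≤ 1 / 2 * (η * G) := by
    have h3 : l * w ^ 2 * η ≤ 1 / 4 := by
      have : ϑ ^ 4 ≤ 1 := pow_le_one₀ hϑ.le hϑ1.le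
      linarith
    calc 2 * (l * w ^ 2 * (η ^ 2 * G)) = 2 * (l * w ^ 2 * η) * (η * G) := by ring
      _ ≤ 2 * (1 / 4) * (η * G) := by gcongr
      _ = _ := by ring
  have h3 : ∀ c x : ℝ, 0 ≤ c → 0 ≤ x → 24 * (c * x) ≤ 24 * c / ϑ * x := by
    intro c x hc hx
    have : 24 * c ≤ 24 * c / ϑ := le_div_self (by positivity) hϑ hϑ1.le
    calc 24 * (c * x) = 24 * c * x := by ring
      _ ≤ _ := by gcongr
  have h4 := h3 l a hl ha
  have h5 := h3 _ P hlw hP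
  have h6 : 64 * (l * t) ≤ trackingWeight l ϑ * t := by
    calc 64 * (l * t) = 64 * l * t := by ring
      _ ≤ _ := by gcongr; exact le_trackingWeight hl hϑ hϑ1
  have h7 : 2 * (r * m) ≤ 1 / 2 * (1 / L * m) := by
    have h8 : 4 * r ≤ 1 / L := by rw [le_div_iff₀ hL]; exact hrL
    have h9 : 4 * r * m ≤ 1 / L * m := by gcongr
    linarith
  have h8 : 1 / (4 * L) * m = 1 / 4 * (1 / L * m) := by field_simp
  have h9 : 0 ≤ 1 / L * m := by positivity
  have g1 : 0 ≤ 52 * l / ϑ ^ 3 * e := by positivity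
  have g2 : 0 ≤ 52 * (l * w ^ 2) / ϑ ^ 3 * Q := by positivity
  have g3 : 0 ≤ l * t := by positivity
  have g4 : 0 ≤ l * a := by positivity
  have g5 : 0 ≤ l * w ^ 2 * P := by positivity
  have e1 : lyapunov l ϑ w r Ψ a e t m P Q = Ψ + 24 * l / ϑ * a
      + 52 * l / ϑ ^ 3 * e + trackingWeight l ϑ * t - 2 * (r * m)
      + 24 * (l * w ^ 2) / ϑ * P + 52 * (l * w ^ 2) / ϑ ^ 3 * Q := by
    unfold lyapunov; ring
  rw [e1]
  linarith

end Lyapunov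

/-! ### Recursions for the means and the consensus errors of the iterates. -/

section Iterates

variable {n p : ℕ} {𝒢 : Digraph (Fin n)} {C S : Matrix (Fin n) (Fin n) ℝ} {q : Fin n → ℝ}
  {f : Fin n → Vec p → ℝ} {α β τ η L μ ϑ δ : ℝ} {v₀ : Fin n → ℝ} {X₀ : Stack n p}

/-- The momentum `τ (Z - X)` of a state. -/
def State.momentum (s : State n p) (τ : ℝ) : Stack n p := τ • (s.Z - s.X)

/-- The points `v_{k,i}⁻¹ x_{k,i}` at which the local gradients are evaluated. -/
def localPoints (C : Matrix (Fin n) (Fin n) ℝ) (f : Fin n → Vec p → ℝ) (α β τ η : ℝ)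
    (v₀ : Fin n → ℝ) (X₀ : Stack n p) (k : ℕ) : Stack n p :=
  fun i => (weights C v₀ k i)⁻¹ • (iterates C f α β τ η v₀ X₀ k).X i

local notation "st" => iterates C f α β τ η v₀ X₀
local notation "pts" => localPoints C f α β τ η v₀ X₀

theorem iterates_X_eq (k : ℕ) : (st k).X = (1 - τ) • (st k).Y + τ • (st k).Z := by
  cases k with
  | zero => simp only [iterates]; module
  | succ k => rfl

theorem iterates_X_succ (k : ℕ) : (st (k + 1)).X =
    mix C ((st k).X + ((1 - β) • (st k).momentum τ + (-((1 - τ + α * τ) * η)) • (st k).G)) := by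
  simp only [iterates]
  rw [← mix_smul, ← mix_smul, ← mix_add]
  congr 1
  simp only [State.momentum]
  module

/-- The factor `τ` in the momentum turns the large stepsize `α η` into `α τ η`, so with `α τ` fixed
the gradient coefficients stay bounded for small `τ`. -/
theorem iterates_momentum_succ (k : ℕ) : (st (k + 1)).momentum τ =
    mix C (((1 - τ) * (1 - β)) • (st k).momentum τ
      + (-((1 - τ) * (α * τ - τ) * η)) • (st k).G) := by
  have h : (st (k + 1)).momentum τ = (τ * (1 - τ)) • ((st (k + 1)).Z - (st (k + 1)).Y) := by
    rw [State.momentum, iterates_X_eq]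
    module
  rw [h]
  simp only [iterates]
  rw [← mix_sub, ← mix_smul]
  congr 1
  simp only [State.momentum]
  module

/-- Gradient tracking: mixing preserves means, and the corrections telescope. -/
theorem rowMean_iterates_G (hC : ∀ j, ∑ i, C i j = 1) (k : ℕ) :
    rowMean (st k).G = rowMean (fun i => gradient (f i) (pts k i)) := by
  induction k with
  | zero => rfl
  | succ k ih =>
    have h : (st (k + 1)).G = mix C (st k).G + (fun i => gradient (f i) (pts (k + 1) i))
      - fun i => gradient (f i) (pts k i) := rfl
    rw [h, rowMean_sub, rowMean_add, rowMean_mix hC, ih, add_sub_cancel_left]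

theorem rowMean_iterates_Y_succ (hC : ∀ j, ∑ i, C i j = 1) (k : ℕ) :
    rowMean (st (k + 1)).Y = rowMean (st k).X - η • rowMean (st k).G := by
  simp only [iterates]
  rw [rowMean_mix hC, rowMean_sub, rowMean_smul]

theorem rowMean_iterates_Z_succ (hC : ∀ j, ∑ i, C i j = 1) (k : ℕ) :
    rowMean (st (k + 1)).Z = (1 - β) • rowMean (st k).Z + β • rowMean (st k).X
      - (α * η) • rowMean (st k).G := by
  simp only [iterates]
  rw [rowMean_mix hC, rowMean_sub, rowMean_add, rowMean_smul, rowMean_smul, rowMean_smul]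

section ConsensusErrors

theorem consensusError_add (X Y : Stack n p) :
    consensusError q (X + Y) = consensusError q X + consensusError q Y := mix_add _ _ _

theorem matNorm_consensusError_smul_sq (c : ℝ) (X : Stack n p) :
    matNorm S (consensusError q (c • X)) ^ 2 = c ^ 2 * matNorm S (consensusError q X) ^ 2 := by
  rw [consensusError, mix_smul, matNorm_sq_smul]; rfl

theorem matNorm_consensusError_add_sq_le_two (X Y : Stack n p) :
    matNorm S (consensusError q (X + Y)) ^ 2 ≤ 2 * matNorm S (consensusError q X) ^ 2
      + 2 * matNorm S (consensusError q Y) ^ 2 := by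
  rw [consensusError_add]; exact matNorm_sq_add_le_two _ _

variable (hn : 0 < n) (hC : IsMixingMatrix 𝒢 C) (hq : IsPerronVector C q)
  (hS : IsMixingNorm C q ϑ S δ) (hϑ : 0 < ϑ)
include hn hC hq hS hϑ

theorem consensus_Y_succ (k : ℕ) :
    matNorm S (consensusError q (st (k + 1)).Y) ^ 2 ≤
      2 * matNorm S (consensusError q (st k).X) ^ 2
        + 2 * (η ^ 2 * matNorm S (consensusError q (st k).G) ^ 2) := by
  have h : (st (k + 1)).Y = mix C ((st k).X + (-η) • (st k).G) := by
    simp only [iterates]; rw [neg_smul, sub_eq_add_neg]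
  rw [h, consensusError_mix hn hC hq]
  refine (hS.matNorm_mix_sq_le hϑ _).trans ((matNorm_consensusError_add_sq_le_two _ _).trans_eq ?_)
  rw [matNorm_consensusError_smul_sq, neg_sq]

variable (hϑ1 : ϑ < 1)
include hϑ1

theorem consensus_mix_add_sq_le (A D : Stack n p) :
    matNorm S (consensusError q (mix C (A + D))) ^ 2 ≤
      (1 - ϑ) * matNorm S (consensusError q A) ^ 2
        + 1 / ϑ * matNorm S (consensusError q D) ^ 2 := by
  rw [consensusError_mix hn hC hq, consensusError_add, mix_add]
  refine (hS.matNorm_mix_add_sq_le hϑ hϑ1 _ _).trans ?_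
  gcongr _ + 1 / ϑ * ?_
  exact hS.matNorm_mix_sq_le hϑ _

theorem consensus_momentum_succ (hα : α * τ = 1 / 12) (hτ : 0 < τ) (hτ1 : τ < 1)
    (hβ : 0 < β) (hβ1 : β ≤ 1) (k : ℕ) :
    matNorm S (consensusError q ((st (k + 1)).momentum τ)) ^ 2 ≤
      (1 - ϑ) * matNorm S (consensusError q ((st k).momentum τ)) ^ 2
      + 1 / ϑ * (1 / 16 * (η ^ 2 * matNorm S (consensusError q (st k).G) ^ 2)) := by
  rw [iterates_momentum_succ]
  refine (consensus_mix_add_sq_le hn hC hq hS hϑ hϑ1 _ _).trans ?_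
  rw [matNorm_consensusError_smul_sq, matNorm_consensusError_smul_sq]
  have h1 : ((1 - τ) * (1 - β)) ^ 2 ≤ 1 :=
    pow_le_one₀ (mul_nonneg (by linarith) (by linarith)) (mul_le_one₀ (by linarith)
      (by linarith) (by linarith))
  have h2 : ((1 - τ) * (α * τ - τ)) ^ 2 ≤ 1 / 16 := by
    have h3 : |(1 - τ) * (α * τ - τ)| ≤ 1 / 4 := by
      rw [hα, abs_le]; constructor <;> nlinarith [sq_nonneg (τ - 1 / 2)]
    have := pow_le_pow_left₀ (abs_nonneg _) h3 2
    rw [sq_abs] at this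
    linarith
  have h3 : 0 ≤ 1 - ϑ := by linarith
  calc _ = (1 - ϑ) * (((1 - τ) * (1 - β)) ^ 2
            * matNorm S (consensusError q ((st k).momentum τ)) ^ 2)
        + 1 / ϑ * (((1 - τ) * (α * τ - τ)) ^ 2
            * (η ^ 2 * matNorm S (consensusError q (st k).G) ^ 2)) := by ring
    _ ≤ (1 - ϑ) * (1 * matNorm S (consensusError q ((st k).momentum τ)) ^ 2)
        + 1 / ϑ * (1 / 16 * (η ^ 2 * matNorm S (consensusError q (st k).G) ^ 2)) := by gcongr
    _ = _ := by rw [one_mul]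

theorem consensus_X_succ (hα : α * τ = 1 / 12) (hτ : 0 < τ) (hτ1 : τ < 1)
    (hβ : 0 < β) (hβ1 : β ≤ 1) (k : ℕ) :
    matNorm S (consensusError q (st (k + 1)).X) ^ 2 ≤
      (1 - ϑ) * matNorm S (consensusError q (st k).X) ^ 2
      + 1 / ϑ * (2 * matNorm S (consensusError q ((st k).momentum τ)) ^ 2
        + 5 / 2 * (η ^ 2 * matNorm S (consensusError q (st k).G) ^ 2)) := by
  rw [iterates_X_succ]
  refine (consensus_mix_add_sq_le hn hC hq hS hϑ hϑ1 _ _).trans ?_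
  gcongr _ + 1 / ϑ * ?_
  refine (matNorm_consensusError_add_sq_le_two _ _).trans ?_
  rw [matNorm_consensusError_smul_sq, matNorm_consensusError_smul_sq]
  have h1 : (1 - β) ^ 2 ≤ 1 := pow_le_one₀ (by linarith) (by linarith)
  have h2 : (1 - τ + α * τ) ^ 2 ≤ 5 / 4 := by rw [hα]; nlinarith
  calc _ = 2 * ((1 - β) ^ 2 * matNorm S (consensusError q ((st k).momentum τ)) ^ 2)
        + 2 * ((1 - τ + α * τ) ^ 2
            * (η ^ 2 * matNorm S (consensusError q (st k).G) ^ 2)) := by ring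
    _ ≤ 2 * (1 * matNorm S (consensusError q ((st k).momentum τ)) ^ 2)
        + 2 * (5 / 4 * (η ^ 2 * matNorm S (consensusError q (st k).G) ^ 2)) := by gcongr
    _ = _ := by ring

theorem consensus_G_succ (k : ℕ) :
    matNorm S (consensusError q (st (k + 1)).G) ^ 2 ≤
      (1 - ϑ) * matNorm S (consensusError q (st k).G) ^ 2
      + 1 / ϑ * ∑ i, ‖gradient (f i) (pts (k + 1) i) - gradient (f i) (pts k i)‖ ^ 2 := by
  have h : (st (k + 1)).G = mix C (st k).G
      + fun i => gradient (f i) (pts (k + 1) i) - gradient (f i) (pts k i) := by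
    rw [← Pi.sub_def, ← add_sub_assoc]; rfl
  rw [h, consensusError_add, consensusError_mix hn hC hq]
  refine (hS.matNorm_mix_add_sq_le hϑ hϑ1 _ _).trans ?_
  gcongr _ + 1 / ϑ * ?_
  exact (hS.matNorm_consensusError_sq_le _).trans (hS.matNorm_sq_le _)

end ConsensusErrors

section Means

/-- Means do not contract under mixing. The damping factor supplies the missing `1 - ϑ`, so they fit
the same scheme as the consensus errors. -/
theorem damped_norm_add_sq_le {E : Type*} [SeminormedAddCommGroup E] (hϑ : 0 < ϑ) (hϑ1 : ϑ < 1)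
    (x d : E) (k : ℕ) :
    (1 - ϑ) ^ (2 * (k + 1)) * ‖x + d‖ ^ 2 ≤
      (1 - ϑ) * ((1 - ϑ) ^ (2 * k) * ‖x‖ ^ 2) + 1 / ϑ * ((1 - ϑ) ^ (2 * k) * ‖d‖ ^ 2) := by
  have h0 : 0 < 1 - ϑ := by linarith
  have h1 : (1 - ϑ) * ‖x + d‖ ≤ (1 - ϑ) * ‖x‖ + ‖d‖ := by
    have h2 : (1 - ϑ) * ‖x + d‖ ≤ (1 - ϑ) * (‖x‖ + ‖d‖) := by gcongr; exact norm_add_le x d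
    have h3 : 0 ≤ ϑ * ‖d‖ := by positivity
    linarith
  have h2 := (pow_le_pow_left₀ (by positivity) h1 2).trans (sq_add_le_div hϑ hϑ1 ‖x‖ ‖d‖)
  calc (1 - ϑ) ^ (2 * (k + 1)) * ‖x + d‖ ^ 2
      = (1 - ϑ) ^ (2 * k) * ((1 - ϑ) * ‖x + d‖) ^ 2 := by ring
    _ ≤ (1 - ϑ) ^ (2 * k) * ((1 - ϑ) * ‖x‖ ^ 2 + 1 / ϑ * ‖d‖ ^ 2) := by gcongr
    _ = _ := by ring

variable (hC : ∀ j, ∑ i, C i j = 1) (hϑ : 0 < ϑ) (hϑ1 : ϑ < 1)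
  (hα : α * τ = 1 / 12) (hτ : 0 < τ) (hτ1 : τ < 1) (hβ : 0 < β) (hβ1 : β ≤ 1)
include hC hϑ hϑ1 hα hτ hτ1 hβ hβ1

theorem mean_momentum_succ (k : ℕ) :
    (1 - ϑ) ^ (2 * (k + 1)) * ‖rowMean ((st (k + 1)).momentum τ)‖ ^ 2 ≤
      (1 - ϑ) * ((1 - ϑ) ^ (2 * k) * ‖rowMean ((st k).momentum τ)‖ ^ 2)
      + 1 / ϑ * (1 / 16 * (η ^ 2 * ‖rowMean (st k).G‖ ^ 2)) := by
  rw [iterates_momentum_succ, rowMean_mix hC, rowMean_add, rowMean_smul, rowMean_smul]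
  refine (damped_norm_add_sq_le hϑ hϑ1 _ _ k).trans ?_
  rw [norm_smul, norm_smul, mul_pow, mul_pow, Real.norm_eq_abs, Real.norm_eq_abs, sq_abs, sq_abs]
  have h1 : ((1 - τ) * (1 - β)) ^ 2 ≤ 1 :=
    pow_le_one₀ (mul_nonneg (by linarith) (by linarith)) (mul_le_one₀ (by linarith)
      (by linarith) (by linarith))
  have h2 : ((1 - τ) * (α * τ - τ)) ^ 2 ≤ 1 / 16 := by
    have h3 : |(1 - τ) * (α * τ - τ)| ≤ 1 / 4 := by
      rw [hα, abs_le]; constructor <;> nlinarith [sq_nonneg (τ - 1 / 2)]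
    have := pow_le_pow_left₀ (abs_nonneg _) h3 2
    rw [sq_abs] at this
    linarith
  have h3 : 0 ≤ 1 - ϑ := by linarith
  -- The damping is discarded on the gradient term only, which the undamped surplus `5 η ‖g‖²` pays
  -- for.
  have h4 : (1 - ϑ) ^ (2 * k) ≤ 1 := pow_le_one₀ h3 (by linarith)
  calc _ = (1 - ϑ) * ((1 - ϑ) ^ (2 * k) * (((1 - τ) * (1 - β)) ^ 2
            * ‖rowMean ((st k).momentum τ)‖ ^ 2))
        + 1 / ϑ * ((1 - ϑ) ^ (2 * k) * (((1 - τ) * (α * τ - τ)) ^ 2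
            * (η ^ 2 * ‖rowMean (st k).G‖ ^ 2))) := by ring
    _ ≤ (1 - ϑ) * ((1 - ϑ) ^ (2 * k) * (1 * ‖rowMean ((st k).momentum τ)‖ ^ 2))
        + 1 / ϑ * (1 * (1 / 16 * (η ^ 2 * ‖rowMean (st k).G‖ ^ 2))) := by gcongr
    _ = _ := by ring

theorem mean_X_succ (k : ℕ) :
    (1 - ϑ) ^ (2 * (k + 1)) * ‖rowMean (st (k + 1)).X‖ ^ 2 ≤
      (1 - ϑ) * ((1 - ϑ) ^ (2 * k) * ‖rowMean (st k).X‖ ^ 2)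
      + 1 / ϑ * (2 * ((1 - ϑ) ^ (2 * k) * ‖rowMean ((st k).momentum τ)‖ ^ 2)
        + 5 / 2 * (η ^ 2 * ‖rowMean (st k).G‖ ^ 2)) := by
  rw [iterates_X_succ, rowMean_mix hC, rowMean_add]
  refine (damped_norm_add_sq_le hϑ hϑ1 _ _ k).trans ?_
  gcongr _ + 1 / ϑ * ?_
  rw [rowMean_add, rowMean_smul, rowMean_smul]
  have h0 := norm_add_sq_le_two ((1 - β) • rowMean ((st k).momentum τ))
    ((-((1 - τ + α * τ) * η)) • rowMean (st k).G)
  rw [norm_smul, norm_smul, mul_pow, mul_pow, Real.norm_eq_abs, Real.norm_eq_abs, sq_abs,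
    sq_abs] at h0
  have h1 : (1 - β) ^ 2 ≤ 1 := pow_le_one₀ (by linarith) (by linarith)
  have h2 : (1 - τ + α * τ) ^ 2 ≤ 5 / 4 := by rw [hα]; nlinarith
  have h3 : 0 ≤ 1 - ϑ := by linarith
  have h4 : (1 - ϑ) ^ (2 * k) ≤ 1 := pow_le_one₀ h3 (by linarith)
  calc _ ≤ (1 - ϑ) ^ (2 * k) * (2 * ((1 - β) ^ 2 * ‖rowMean ((st k).momentum τ)‖ ^ 2)
        + 2 * ((-((1 - τ + α * τ) * η)) ^ 2 * ‖rowMean (st k).G‖ ^ 2)) := by gcongr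
    _ = 2 * ((1 - ϑ) ^ (2 * k) * ((1 - β) ^ 2 * ‖rowMean ((st k).momentum τ)‖ ^ 2))
        + 2 * ((1 - ϑ) ^ (2 * k) * ((1 - τ + α * τ) ^ 2
          * (η ^ 2 * ‖rowMean (st k).G‖ ^ 2))) := by ring
    _ ≤ 2 * ((1 - ϑ) ^ (2 * k) * (1 * ‖rowMean ((st k).momentum τ)‖ ^ 2))
        + 2 * (1 * (5 / 4 * (η ^ 2 * ‖rowMean (st k).G‖ ^ 2))) := by gcongr
    _ = _ := by ring

end Means

end Iterates

/-! ### The gap at the local outputs, compared with the gap at a common point. -/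

section OutputGap

variable {n p : ℕ} {f : Fin n → Vec p → ℝ} {L : ℝ}

theorem mean_gap_le (hn : 0 < n) (hL : 0 < L) (hf : ∀ i, IsConvexSmooth L (f i)) {xs : Vec p}
    (hxs : ∀ x, objective f xs ≤ objective f x) (u : Stack n p) (y : Vec p) :
    (1 / (n : ℝ)) * ∑ i, objective f (u i) - objective f xs ≤
      2 * (objective f y - objective f xs) + L * dispersion u y := by
  nth_rewrite 1 [← mean_const hn (objective f xs)]
  rw [← mean_const hn (2 * (objective f y - objective f xs)), ← mul_sub,
    ← Finset.sum_sub_distrib]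
  unfold dispersion
  rw [mul_left_comm L, Finset.mul_sum _ _ L, ← mul_add, ← Finset.sum_add_distrib]
  gcongr with i
  exact (isConvexSmooth_objective hn hf).gap_le_two_mul hL hxs y (u i)

end OutputGap

/-! ### Contraction of the Lyapunov function along the iterates. -/

section Convergence

variable {n p : ℕ} {𝒢 : Digraph (Fin n)} {C S : Matrix (Fin n) (Fin n) ℝ} {q : Fin n → ℝ}
  {f : Fin n → Vec p → ℝ} {α β τ η L μ ϑ δ κ l w : ℝ} {v₀ : Fin n → ℝ} {X₀ : Stack n p}
  {xs : Vec p}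

local notation "st" => iterates C f α β τ η v₀ X₀
local notation "pts" => localPoints C f α β τ η v₀ X₀

/-- The conditions on the parameters which the Lyapunov argument uses. -/
structure StepConditions (N L μ ϑ l w α β τ η : ℝ) : Prop where
  alpha_mul_tau : α * τ = 1 / 12
  tau_pos : 0 < τ
  tau_lt_one : τ < 1
  eta_pos : 0 < η
  smooth : L * η ≤ 1 / 2
  beta_pos : 0 < β
  beta_le_tau : β ≤ τ
  beta_le : β ≤ ϑ / 16
  beta_le_mu : β ≤ μ * α * η / 2
  tracking : 4 * (trackingWeight l ϑ * η ^ 2 * N / ϑ) * L ≤ 1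
  weights : 15 * l * w ^ 2 * η ≤ ϑ ^ 4

/-- The potential of the accelerated method on the averages. -/
def potential (C : Matrix (Fin n) (Fin n) ℝ) (f : Fin n → Vec p → ℝ) (α β τ η : ℝ)
    (v₀ : Fin n → ℝ) (X₀ : Stack n p) (xs : Vec p) (k : ℕ) : ℝ :=
  12 * (1 - τ) * (objective f (rowMean (iterates C f α β τ η v₀ X₀ k).Y) - objective f xs)
    + 72 * τ ^ 2 / η * ‖rowMean (iterates C f α β τ η v₀ X₀ k).Z - xs‖ ^ 2

/-- The weighted mean squared differences of the local gradients at the local points and at the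
mean of `Y`, respectively at the minimizer. -/
def gradientGap (C : Matrix (Fin n) (Fin n) ℝ) (f : Fin n → Vec p → ℝ) (α β τ η : ℝ)
    (v₀ : Fin n → ℝ) (X₀ : Stack n p) (xs : Vec p) (k : ℕ) : ℝ :=
  (1 - τ) * gradDispersion f (localPoints C f α β τ η v₀ X₀ k)
      (rowMean (iterates C f α β τ η v₀ X₀ k).Y)
    + τ * gradDispersion f (localPoints C f α β τ η v₀ X₀ k) xs

/-- The Lyapunov function along the iterates. -/
def energy (C S : Matrix (Fin n) (Fin n) ℝ) (q : Fin n → ℝ) (f : Fin n → Vec p → ℝ)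
    (α β τ η ϑ l : ℝ) (v₀ : Fin n → ℝ) (X₀ : Stack n p) (xs : Vec p) (k : ℕ) : ℝ :=
  lyapunov l ϑ (vecNorm S (v₀ - q)) (trackingWeight l ϑ * η ^ 2 * n / ϑ)
    (potential C f α β τ η v₀ X₀ xs k)
    (matNorm S (consensusError q (iterates C f α β τ η v₀ X₀ k).X) ^ 2)
    (matNorm S (consensusError q ((iterates C f α β τ η v₀ X₀ k).momentum τ)) ^ 2)
    (η ^ 2 * matNorm S (consensusError q (iterates C f α β τ η v₀ X₀ k).G) ^ 2)
    (gradientGap C f α β τ η v₀ X₀ xs k)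
    ((1 - ϑ) ^ (2 * k) * ‖rowMean (iterates C f α β τ η v₀ X₀ k).X‖ ^ 2)
    ((1 - ϑ) ^ (2 * k) * ‖rowMean ((iterates C f α β τ η v₀ X₀ k).momentum τ)‖ ^ 2)

theorem gradientGap_nonneg (hτ : 0 ≤ τ) (hτ1 : τ ≤ 1) (k : ℕ) :
    0 ≤ gradientGap C f α β τ η v₀ X₀ xs k :=
  add_nonneg (mul_nonneg (sub_nonneg.2 hτ1) (gradDispersion_nonneg _ _ _))
    (mul_nonneg hτ (gradDispersion_nonneg _ _ _))

theorem potential_nonneg (hτ1 : τ ≤ 1) (hη : 0 < η)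
    (hxs : ∀ x, objective f xs ≤ objective f x) (k : ℕ) :
    0 ≤ potential C f α β τ η v₀ X₀ xs k := by
  have h1 : 0 ≤ 1 - τ := by linarith
  have h2 := sub_nonneg.2 (hxs (rowMean (st k).Y))
  unfold potential
  positivity

section Bounds

variable (hn : 0 < n) (hC : IsMixingMatrix 𝒢 C) (hL : 0 < L)
  (hv₀ : ∀ i, 0 < v₀ i) (hv₀n : ∑ i, v₀ i = n) (hq : IsPerronVector C q) (hϑ1 : ϑ < 1)
  (hS : IsMixingNorm C q ϑ S δ) (hκ : ∀ k i, (weights C v₀ k i)⁻¹ ≤ κ)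
  (hl : l = 2 * δ ^ 2 * κ ^ 2 * L / n)
include hn hC hL hv₀ hv₀n hq hϑ1 hS hκ hl

/-- This estimate fixes the constant `l` and explains the damped means: the decay of the weight
error multiplies the mean. -/
theorem mul_dispersion_le (k : ℕ) (X : Stack n p) :
    L * dispersion (fun i => (weights C v₀ k i)⁻¹ • X i) (rowMean X) ≤
      l * (matNorm S (consensusError q X) ^ 2
        + vecNorm S (v₀ - q) ^ 2 * ((1 - ϑ) ^ (2 * k) * ‖rowMean X‖ ^ 2)) := by
  have h := hS.dispersion_le hn (weights_pos hn hC hv₀ k) (hκ k)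
    (hS.vecNorm_weights_sub_le hC hq hϑ1 hv₀n k) X
  have hn' : (0 : ℝ) < n := by positivity
  rw [hl]
  have h2 := mul_le_mul_of_nonneg_left h (by positivity : 0 ≤ L / n)
  have e : L / n * (n * dispersion (fun i => (weights C v₀ k i)⁻¹ • X i) (rowMean X))
      = L * dispersion (fun i => (weights C v₀ k i)⁻¹ • X i) (rowMean X) := by field_simp
  rw [e] at h2
  refine h2.trans_eq ?_
  rw [mul_pow, ← pow_mul, mul_comm k 2]
  ring

theorem mul_dispersion_Y_succ_le (hϑ : 0 < ϑ) (k : ℕ) :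
    L * dispersion (fun i => (weights C v₀ (k + 1) i)⁻¹ • (st (k + 1)).Y i)
        (rowMean (st (k + 1)).Y) ≤
      l * (2 * matNorm S (consensusError q (st k).X) ^ 2
        + 2 * (η ^ 2 * matNorm S (consensusError q (st k).G) ^ 2)
        + vecNorm S (v₀ - q) ^ 2 * (2 * ((1 - ϑ) ^ (2 * k) * ‖rowMean (st k).X‖ ^ 2)
          + 2 * (η ^ 2 * ‖rowMean (st k).G‖ ^ 2))) := by
  refine (mul_dispersion_le hn hC hL hv₀ hv₀n hq hϑ1 hS hκ hl (k + 1) _).trans ?_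
  have hl0 : 0 ≤ l := by rw [hl]; positivity
  have h0 : 0 ≤ 1 - ϑ := by linarith
  have h1 : (1 - ϑ) ^ (2 * (k + 1)) ≤ (1 - ϑ) ^ (2 * k) :=
    pow_le_pow_of_le_one h0 (by linarith) (by lia)
  have h2 : (1 - ϑ) ^ (2 * k) ≤ 1 := pow_le_one₀ h0 (by linarith)
  have h3 : (1 - ϑ) ^ (2 * (k + 1)) * ‖rowMean (st (k + 1)).Y‖ ^ 2 ≤
      2 * ((1 - ϑ) ^ (2 * k) * ‖rowMean (st k).X‖ ^ 2)
        + 2 * (η ^ 2 * ‖rowMean (st k).G‖ ^ 2) := by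
    have h4 := norm_add_sq_le_two (rowMean (st k).X) (-(η • rowMean (st k).G))
    rw [← sub_eq_add_neg, ← rowMean_iterates_Y_succ hC.col_sum, norm_neg, norm_smul, mul_pow,
      Real.norm_eq_abs, sq_abs] at h4
    calc _ ≤ (1 - ϑ) ^ (2 * k) * (2 * ‖rowMean (st k).X‖ ^ 2
          + 2 * (η ^ 2 * ‖rowMean (st k).G‖ ^ 2)) := by gcongr
      _ = 2 * ((1 - ϑ) ^ (2 * k) * ‖rowMean (st k).X‖ ^ 2)
          + 2 * ((1 - ϑ) ^ (2 * k) * (η ^ 2 * ‖rowMean (st k).G‖ ^ 2)) := by ring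
      _ ≤ 2 * ((1 - ϑ) ^ (2 * k) * ‖rowMean (st k).X‖ ^ 2)
          + 2 * (1 * (η ^ 2 * ‖rowMean (st k).G‖ ^ 2)) := by gcongr
      _ = _ := by rw [one_mul]
  have h5 := consensus_Y_succ (f := f) (α := α) (β := β) (τ := τ) (η := η) (v₀ := v₀) (X₀ := X₀)
    hn hC hq hS hϑ k
  gcongr

end Bounds

variable (hn : 0 < n) (hp : 0 < p) (hC : IsMixingMatrix 𝒢 C) (hL : 0 < L) (hμ : 0 < μ)
  (hf : ∀ i, IsConvexSmooth L (f i)) (hfμ : ∀ i, IsStronglyConvex μ (f i))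
  (hv₀ : ∀ i, 0 < v₀ i) (hv₀n : ∑ i, v₀ i = n) (hq : IsPerronVector C q)
  (hϑ : 0 < ϑ) (hϑ1 : ϑ < 1) (hS : IsMixingNorm C q ϑ S δ)
  (hκ : ∀ k i, (weights C v₀ k i)⁻¹ ≤ κ) (hl : l = 2 * δ ^ 2 * κ ^ 2 * L / n)
  (hstep : StepConditions n L μ ϑ l (vecNorm S (v₀ - q)) α β τ η)

section Step

include hn hp hC hL hμ hf hfμ hϑ1 hstep

theorem mean_step (k : ℕ) :
    12 * (1 - β + β * τ) * (objective f (rowMean (st (k + 1)).Y) - objective f xs)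
      + 72 * τ ^ 2 / η * ‖rowMean (st (k + 1)).Z - xs‖ ^ 2 + 5 * η * ‖rowMean (st k).G‖ ^ 2
      + 3 / (2 * L) * gradientGap C f α β τ η v₀ X₀ xs k
      ≤ (1 - β) * potential C f α β τ η v₀ X₀ xs k
        + 21 * L * dispersion (pts k) (rowMean (st k).X) := by
  have hx : rowMean (st k).X = (1 - τ) • rowMean (st k).Y + τ • rowMean (st k).Z := by
    rw [iterates_X_eq k, rowMean_add, rowMean_smul, rowMean_smul]
  exact accelerated_step hn hL hμ ((hfμ ⟨0, hn⟩).le_smoothness (hf ⟨0, hn⟩) hL hp) hf hfμ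
    hstep.alpha_mul_tau hstep.tau_pos hstep.tau_lt_one hstep.eta_pos hstep.smooth
    hstep.beta_pos (by linarith [hstep.beta_le]) hstep.beta_le_mu (pts k)
    (rowMean_iterates_G hC.col_sum k) hx (rowMean_iterates_Y_succ hC.col_sum k)
    (rowMean_iterates_Z_succ hC.col_sum k)

include hv₀ hv₀n hq hϑ hS hκ hl

theorem energy_succ_le (hxs : ∀ x, objective f xs ≤ objective f x) (k : ℕ) :
    energy C S q f α β τ η ϑ l v₀ X₀ xs (k + 1) ≤
      (1 - β) * energy C S q f α β τ η ϑ l v₀ X₀ xs k := by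
  have hl0 : 0 ≤ l := by rw [hl]; positivity
  have h0 : 0 ≤ 1 - ϑ := by linarith
  have hβ1 : β ≤ 1 := by linarith [hstep.beta_le]
  have hτ := hstep.tau_pos
  have hτ1 := hstep.tau_lt_one
  have hη := hstep.eta_pos
  refine lyapunov_step (L := L) (N := n) (η := η) (G := ‖rowMean (st k).G‖ ^ 2)
    (D := dispersion (pts k) (rowMean (st k).X)) hl0 hϑ hϑ1 hstep.beta_pos
    hstep.beta_le hL hη hstep.smooth (by positivity) rfl hstep.tracking hstep.weights
    (by positivity) (by positivity) (by positivity) (gradientGap_nonneg hτ.le hτ1.le k)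
    (by positivity) (by positivity) (by positivity) (dispersion_nonneg _ _) ?_
    (mul_dispersion_le hn hC hL hv₀ hv₀n hq hϑ1 hS hκ hl k _) ?_
    (consensus_momentum_succ hn hC hq hS hϑ hϑ1 hstep.alpha_mul_tau hτ hτ1 hstep.beta_pos hβ1 k)
    (consensus_X_succ hn hC hq hS hϑ hϑ1 hstep.alpha_mul_tau hτ hτ1 hstep.beta_pos hβ1 k)
    (mean_momentum_succ hC.col_sum hϑ hϑ1 hstep.alpha_mul_tau hτ hτ1 hstep.beta_pos hβ1 k)
    (mean_X_succ hC.col_sum hϑ hϑ1 hstep.alpha_mul_tau hτ hτ1 hstep.beta_pos hβ1 k)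
  · have h1 := mean_step hn hp hC hL hμ hf hfμ hϑ1 hstep k (xs := xs) (X₀ := X₀)
    have h2 := sub_nonneg.2 (hxs (rowMean (st (k + 1)).Y))
    -- Here `β ≤ τ` is needed: the step yields the gap with weight `1 - β + β τ`, the next potential
    -- asks for `1 - τ`.
    have h3 : 12 * (1 - τ) * (objective f (rowMean (st (k + 1)).Y) - objective f xs)
        ≤ 12 * (1 - β + β * τ) * (objective f (rowMean (st (k + 1)).Y) - objective f xs) := by
      have : 0 ≤ β * τ := mul_nonneg hstep.beta_pos.le hτ.le
      gcongr
      linarith [hstep.beta_le_tau]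
    rw [potential]
    linarith
  · have h1 := consensus_G_succ (f := f) (α := α) (β := β) (τ := τ) (η := η) (v₀ := v₀) (X₀ := X₀)
      hn hC hq hS hϑ hϑ1 k
    have h2 := mean_gradient_diff_le hn hL hf hτ.le hτ1.le (pts k) (pts (k + 1))
      (rowMean (st k).X) (rowMean (st k).Y) (rowMean (st (k + 1)).Y) xs (η • rowMean (st k).G)
      (rowMean_iterates_Y_succ hC.col_sum k)
    rw [norm_smul, mul_pow, Real.norm_eq_abs, sq_abs] at h2
    have h3 := mul_le_mul_of_nonneg_left h2 (by positivity : (0 : ℝ) ≤ n)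
    rw [← mul_assoc, mul_one_div_cancel (by positivity), one_mul] at h3
    calc _ ≤ η ^ 2 * ((1 - ϑ) * matNorm S (consensusError q (st k).G) ^ 2
          + 1 / ϑ * (n * (2 * gradientGap C f α β τ η v₀ X₀ xs (k + 1)
            + 2 * gradientGap C f α β τ η v₀ X₀ xs k
            + 4 * L ^ 2 * (η ^ 2 * ‖rowMean (st k).G‖ ^ 2)
            + 4 * L ^ 2 * dispersion (pts k) (rowMean (st k).X)))) := by
          refine mul_le_mul_of_nonneg_left (h1.trans ?_) (by positivity)
          gcongr _ + 1 / ϑ * ?_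
          exact h3
      _ = _ := by ring

/-- The output is compared with the preceding energy: the dispersion of the new `Y` involves the
preceding gradient mean, which only that step controls. -/
theorem outputGap_succ_le (hxs : ∀ x, objective f xs ≤ objective f x) (k : ℕ) :
    outputGap C f α β τ η v₀ X₀ xs (k + 1) ≤
      1 / 4 * energy C S q f α β τ η ϑ l v₀ X₀ xs k := by
  have hl0 : 0 ≤ l := by rw [hl]; positivity
  have h0 : 0 ≤ 1 - ϑ := by linarith
  have hτ := hstep.tau_pos
  have hτ1 := hstep.tau_lt_one
  have hη := hstep.eta_pos
  have hgap := mean_gap_le hn hL hf hxs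
    (fun i => (weights C v₀ (k + 1) i)⁻¹ • (st (k + 1)).Y i) (rowMean (st (k + 1)).Y)
  refine hgap.trans ?_
  refine output_le_lyapunov (L := L) (η := η) (G := ‖rowMean (st k).G‖ ^ 2)
    (D := dispersion (pts k) (rowMean (st k).X)) hl0 hϑ hϑ1 hstep.beta_pos
    (by linarith [hstep.beta_le]) hL hη hstep.tracking hstep.weights
    (by positivity) (by positivity) (by positivity) (gradientGap_nonneg hτ.le hτ1.le k)
    (by positivity) (by positivity) (by positivity) (potential_nonneg hτ1.le hη hxs k) ?_
    (mul_dispersion_le hn hC hL hv₀ hv₀n hq hϑ1 hS hκ hl k _)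
    (mul_dispersion_Y_succ_le hn hC hL hv₀ hv₀n hq hϑ1 hS hκ hl hϑ k)
  have h1 := mean_step hn hp hC hL hμ hf hfμ hϑ1 hstep k (xs := xs) (X₀ := X₀)
  have h2 := sub_nonneg.2 (hxs (rowMean (st (k + 1)).Y))
  have h3 : 0 ≤ 12 * (β * τ) * (objective f (rowMean (st (k + 1)).Y) - objective f xs) := by
    have := hstep.beta_pos
    positivity
  have h4 : 0 ≤ 72 * τ ^ 2 / η * ‖rowMean (st (k + 1)).Z - xs‖ ^ 2 := by positivity
  linarith

theorem outputGap_succ_le_pow (hxs : ∀ x, objective f xs ≤ objective f x) (k : ℕ) :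
    outputGap C f α β τ η v₀ X₀ xs (k + 1) ≤ 1 / 4 * ((1 - β) ^ k *
      (12 * (1 - τ) * (objective f (rowMean X₀) - objective f xs)
        + 72 * τ ^ 2 / η * ‖rowMean X₀ - xs‖ ^ 2
        + 24 * l / ϑ * matNorm S (consensusError q X₀) ^ 2
        + trackingWeight l ϑ
          * (η ^ 2 * matNorm S (consensusError q (stackedGradient f v₀ X₀)) ^ 2)
        + vecNorm S (v₀ - q) ^ 2 * (24 * l / ϑ * ‖rowMean X₀‖ ^ 2))) := by
  refine (outputGap_succ_le hn hp hC hL hμ hf hfμ hv₀ hv₀n hq hϑ hϑ1 hS hκ hl hstep hxs k).trans ?_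
  have hβ1 : 0 ≤ 1 - β := by linarith [hstep.beta_le]
  have hη := hstep.eta_pos
  have hl0 : 0 ≤ l := by rw [hl]; positivity
  have hT : 0 ≤ trackingWeight l ϑ := le_trans (by positivity) (le_trackingWeight hl0 hϑ hϑ1)
  gcongr
  induction k with
  | zero =>
    -- The start `Z₀ = X₀` removes both momentum terms; the subtracted gradient term is nonnegative
    -- and is dropped.
    have hm : (st 0).momentum τ = 0 := by simp [State.momentum, iterates]
    have h1 : consensusError q (0 : Stack n p) = 0 := by
      funext i; simp [consensusError, mix]
    have h2 : matNorm S (0 : Stack n p) ^ 2 = 0 := by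
      rw [matNorm_sq]
      refine Finset.sum_eq_zero fun c _ => ?_
      rw [vecNorm_sq]
      simp [← Pi.zero_def]
    have h3 : rowMean (0 : Stack n p) = 0 := by simp [rowMean]
    have h4 := gradientGap_nonneg (C := C) (f := f) (α := α) (β := β) (τ := τ) (η := η) (v₀ := v₀)
      (X₀ := X₀) (xs := xs) hstep.tau_pos.le hstep.tau_lt_one.le 0
    have h5 : 0 ≤ trackingWeight l ϑ * η ^ 2 * n / ϑ := by positivity
    have h6 := mul_nonneg h5 h4
    rw [energy, lyapunov, hm, h1, h2, h3, potential]
    simp only [iterates, mul_zero, pow_zero, norm_zero, one_mul]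
    linarith
  | succ k ih =>
    refine (energy_succ_le hn hp hC hL hμ hf hfμ hv₀ hv₀n hq hϑ hϑ1 hS hκ hl hstep hxs k).trans ?_
    rw [pow_succ', mul_assoc]
    gcongr

end Step

end Convergence

/-! ### From the stated parameter conditions to those of the Lyapunov argument. -/

section Parameters

variable {L μ ϑ δ κ w α β τ η l : ℝ} {n : ℕ}

theorem piThree_eq (ϑ : ℝ) : piThree ϑ (1 / 12) = 37 / 21 * ϑ + 8 / 147 := by
  unfold piThree; ring

/-- The second bound on the stepsize in polynomial form. -/
theorem le_div_of_sqrt_bound {a b x D : ℝ} (hb : 0 < b) (hD : 0 < D)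
    (hab : 2500 * a ≤ 64 * b) (hx : 0 ≤ x) (h : η ≤ Real.sqrt a * x / (8 * Real.sqrt b * D)) :
    50 * (η * D) ≤ x := by
  have hsb : 0 < Real.sqrt b := Real.sqrt_pos.2 hb
  have h1 : 50 * Real.sqrt a ≤ 8 * Real.sqrt b := by
    have h2 : Real.sqrt (2500 * a) ≤ Real.sqrt (64 * b) := Real.sqrt_le_sqrt hab
    rw [Real.sqrt_mul (by norm_num), Real.sqrt_mul (by norm_num),
      show (2500 : ℝ) = 50 ^ 2 by norm_num, show (64 : ℝ) = 8 ^ 2 by norm_num,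
      Real.sqrt_sq (by norm_num), Real.sqrt_sq (by norm_num)] at h2
    exact h2
  rw [le_div_iff₀ (by positivity)] at h
  refine le_of_mul_le_mul_left ?_ (by positivity : 0 < 8 * Real.sqrt b)
  calc 8 * Real.sqrt b * (50 * (η * D)) = 50 * (η * (8 * Real.sqrt b * D)) := by ring
    _ ≤ 50 * (Real.sqrt a * x) := by gcongr
    _ = 50 * Real.sqrt a * x := by ring
    _ ≤ 8 * Real.sqrt b * x := by gcongr

theorem Admissible.stepConditions (hn : 0 < n) (hL : 0 < L) (hϑ : 0 < ϑ) (hϑ1 : ϑ < 1)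
    (hδ : 1 ≤ δ) (hκ : 1 ≤ κ) (h : Admissible n L μ ϑ δ κ w α β τ η)
    (hl : l = 2 * δ ^ 2 * κ ^ 2 * L / n) : StepConditions n L μ ϑ l w α β τ η := by
  have hn' : (0 : ℝ) < n := by positivity
  have hα := h.alpha_mul_tau
  have hη := h.eta_pos
  refine ⟨hα, h.tau_pos, h.tau_lt_one, hη, ?_, h.beta_pos, h.beta_le₁, h.beta_le₂, h.beta_le₄,
    ?_, ?_⟩
  · have h3 := h.eta_le₃
    rw [hα, le_div_iff₀ (by positivity)] at h3
    linarith
  · have h2 := h.eta_le₂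
    rw [hα, piThree_eq, mul_assoc (8 * _) δ, mul_assoc (8 * _) (δ * κ)] at h2
    -- The constant term `8/147` of `piThree` alone suffices for the factor `50`; any factor whose
    -- square is at least `540` would do below.
    have h3 : 50 * (η * (δ * κ * L)) ≤ ϑ ^ 3 :=
      le_div_of_sqrt_bound (by positivity) (by positivity) (by linarith) (by positivity) h2
    have h4 : (50 * (η * (δ * κ * L))) ^ 2 ≤ (ϑ ^ 3) ^ 2 := by gcongr
    have e : 4 * (trackingWeight l ϑ * η ^ 2 * n / ϑ) * L
        = 8 * (64 * ϑ ^ 2 + 7 / 2) * (η * (δ * κ * L)) ^ 2 / ϑ ^ 6 := by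
      unfold trackingWeight
      rw [hl]; field_simp; ring
    rw [e, div_le_one (by positivity)]
    have h5 : ϑ ^ 2 ≤ 1 := pow_le_one₀ hϑ.le hϑ1.le
    calc 8 * (64 * ϑ ^ 2 + 7 / 2) * (η * (δ * κ * L)) ^ 2
        ≤ 8 * (64 * 1 + 7 / 2) * (η * (δ * κ * L)) ^ 2 := by gcongr
      _ = 540 / 2500 * (50 * (η * (δ * κ * L))) ^ 2 := by ring
      _ ≤ 540 / 2500 * (ϑ ^ 3) ^ 2 := by gcongr
      _ ≤ 1 * (ϑ ^ 3) ^ 2 := by gcongr; norm_num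
      _ = ϑ ^ 6 := by ring
  · have h1 := h.eta_le₁
    rw [hα] at h1
    have hX : 0 ≤ η * (δ ^ 2 * κ ^ 2 * w ^ 2 * L) := by positivity
    have h2 : 30 * (η * (δ ^ 2 * κ ^ 2 * w ^ 2 * L)) ≤ n * ϑ ^ 4 := by linarith
    rw [hl]
    calc 15 * (2 * δ ^ 2 * κ ^ 2 * L / n) * w ^ 2 * η
        = 30 * (η * (δ ^ 2 * κ ^ 2 * w ^ 2 * L)) / n := by ring
      _ ≤ n * ϑ ^ 4 / n := by gcongr
      _ = ϑ ^ 4 := by field_simp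

theorem trackingWeight_le (hϑ : 0 < ϑ) (hϑ1 : ϑ < 1) (hl : 0 ≤ l) :
    trackingWeight l ϑ ≤ 480 * l / ϑ * (piThree ϑ (1 / 12) / ϑ ^ 4) := by
  have e : trackingWeight l ϑ = l / ϑ ^ 5 * (64 * ϑ ^ 2 + 7 / 2) := by
    unfold trackingWeight; field_simp
  have e2 : 480 * l / ϑ * (piThree ϑ (1 / 12) / ϑ ^ 4)
      = l / ϑ ^ 5 * (480 * piThree ϑ (1 / 12)) := by field_simp
  rw [e, e2, piThree_eq]
  gcongr
  nlinarith

end Parameters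

/-! ### The explicit bound for the output. -/

section Bound

variable {n p : ℕ} {𝒢 : Digraph (Fin n)} {C S : Matrix (Fin n) (Fin n) ℝ} {q : Fin n → ℝ}
  {f : Fin n → Vec p → ℝ} {α β τ η L μ ϑ δ κ : ℝ} {v₀ : Fin n → ℝ} {X₀ : Stack n p}
  {xs : Vec p}

theorem phiThree_le (hn : 0 < n) (hϑ : 0 < ϑ) (hτ : 0 < τ) (hτ1 : τ < 1) (X₀ : Stack n p) :
    phiThree ϑ τ X₀ ≤ (1 + 8 / ϑ ^ 2) * ∑ i, ‖X₀ i‖ ^ 2 := by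
  have h1 : ‖rowMean X₀‖ ^ 2 ≤ ∑ i, ‖X₀ i‖ ^ 2 := by
    refine (norm_rowMean_sq_le hn X₀).trans (mul_le_of_le_one_left (by positivity) ?_)
    rw [div_le_one (by positivity)]
    exact_mod_cast hn
  have h2 : τ ^ 2 ≤ 1 := pow_le_one₀ hτ.le hτ1.le
  unfold phiThree
  calc _ ≤ ‖rowMean X₀‖ ^ 2 + 8 / ϑ ^ 2 * 1 * ‖rowMean X₀‖ ^ 2 := by gcongr
    _ = (1 + 8 / ϑ ^ 2) * ‖rowMean X₀‖ ^ 2 := by ring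
    _ ≤ _ := by gcongr

theorem outputGap_nonneg (hn : 0 < n) (hxs : ∀ x, objective f xs ≤ objective f x) (K : ℕ) :
    0 ≤ outputGap C f α β τ η v₀ X₀ xs K := by
  unfold outputGap
  rw [sub_nonneg]
  nth_rewrite 1 [← mean_const hn (objective f xs)]
  gcongr with i
  exact hxs _

/-- The second factor of the bound on the output. -/
def initialBound (f : Fin n → Vec p → ℝ) (q : Fin n → ℝ) (S : Matrix (Fin n) (Fin n) ℝ)
    (L ϑ δ κ α β τ η : ℝ) (v₀ : Fin n → ℝ) (X₀ : Stack n p) (xs : Vec p) : ℝ :=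
  18 * (1 - β) * (1 - τ) * (objective f (rowMean X₀) - objective f xs)
    + 960 * δ ^ 2 * κ ^ 2 * L / (n * ϑ)
      * phiFour q S ϑ (α * τ) η X₀ (stackedGradient f v₀ X₀)
    + 180 * δ ^ 2 * κ ^ 2 * L * vecNorm S (v₀ - q) ^ 2 / (n * ϑ) * phiThree ϑ τ X₀
    + (1 - β) / (2 * α ^ 2 * η) * ‖rowMean X₀ - xs‖ ^ 2

variable (hn : 0 < n) (hp : 0 < p) (hC : IsMixingMatrix 𝒢 C) (hL : 0 < L) (hμ : 0 < μ)
  (hf : ∀ i, IsConvexSmooth L (f i)) (hfμ : ∀ i, IsStronglyConvex μ (f i))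
  (hxs : ∀ x, objective f xs ≤ objective f x)
  (hv₀ : ∀ i, 0 < v₀ i) (hv₀n : ∑ i, v₀ i = n) (hq : IsPerronVector C q)
  (hϑ : 0 < ϑ) (hϑ1 : ϑ < 1) (hS : IsMixingNorm C q ϑ S δ) (hκ1 : 1 ≤ κ)
  (hκ : ∀ k i, (weights C v₀ k i)⁻¹ ≤ κ)
  (hadm : Admissible n L μ ϑ δ κ (vecNorm S (v₀ - q)) α β τ η)

include hn hL hϑ hϑ1 hadm

theorem le_initialBound {l : ℝ} (hl : l = 2 * δ ^ 2 * κ ^ 2 * L / n) :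
    (1 - β) * (18 * (1 - τ) * (objective f (rowMean X₀) - objective f xs)
        + 72 * τ ^ 2 / η * ‖rowMean X₀ - xs‖ ^ 2)
      + 480 * l / ϑ * matNorm S (consensusError q X₀) ^ 2
      + trackingWeight l ϑ
          * (η ^ 2 * matNorm S (consensusError q (stackedGradient f v₀ X₀)) ^ 2)
      + vecNorm S (v₀ - q) ^ 2 * (90 * l / ϑ * ‖rowMean X₀‖ ^ 2)
      ≤ initialBound f q S L ϑ δ κ α β τ η v₀ X₀ xs := by
  have hn' : (0 : ℝ) < n := by positivity
  have hl0 : 0 ≤ l := by rw [hl]; positivity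
  have hτ := hadm.tau_pos
  have hη := hadm.eta_pos
  have e1 : 960 * δ ^ 2 * κ ^ 2 * L / (n * ϑ) = 480 * l / ϑ := by rw [hl]; field_simp; ring
  have e2 : 180 * δ ^ 2 * κ ^ 2 * L * vecNorm S (v₀ - q) ^ 2 / (n * ϑ)
      = 90 * l / ϑ * vecNorm S (v₀ - q) ^ 2 := by rw [hl]; field_simp; ring
  have e3 : (1 - β) / (2 * α ^ 2 * η) = (1 - β) * (72 * τ ^ 2 / η) := by
    have : α = 1 / (12 * τ) := by
      have := hadm.alpha_mul_tau
      field_simp; linarith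
    rw [this]; field_simp; ring
  have h1 : matNorm S (consensusError q X₀) ^ 2
      + piThree ϑ (1 / 12) / ϑ ^ 4
        * (η ^ 2 * matNorm S (consensusError q (stackedGradient f v₀ X₀)) ^ 2)
      ≤ phiFour q S ϑ (α * τ) η X₀ (stackedGradient f v₀ X₀) := by
    rw [phiFour, hadm.alpha_mul_tau]
    have h2 : 0 ≤ 24 / (7 * ϑ ^ 2) * matNorm S (consensusError q X₀) ^ 2 := by positivity
    have h3 : piThree ϑ (1 / 12) / ϑ ^ 4
        * (η ^ 2 * matNorm S (consensusError q (stackedGradient f v₀ X₀)) ^ 2)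
      = piThree ϑ (1 / 12) * η ^ 2 / ϑ ^ 4
        * matNorm S (consensusError q (stackedGradient f v₀ X₀)) ^ 2 := by ring
    linarith
  have h2 : ‖rowMean X₀‖ ^ 2 ≤ phiThree ϑ τ X₀ := by
    unfold phiThree
    have : 0 ≤ 8 / ϑ ^ 2 * τ ^ 2 * ‖rowMean X₀‖ ^ 2 := by positivity
    linarith
  have h3 := mul_le_mul_of_nonneg_left h1 (by positivity : 0 ≤ 480 * l / ϑ)
  have h4 := mul_le_mul_of_nonneg_left h2
    (by positivity : 0 ≤ 90 * l / ϑ * vecNorm S (v₀ - q) ^ 2)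
  have h5 := mul_le_mul_of_nonneg_right (trackingWeight_le hϑ hϑ1 hl0)
    (by positivity :
      0 ≤ η ^ 2 * matNorm S (consensusError q (stackedGradient f v₀ X₀)) ^ 2)
  unfold initialBound
  rw [e1, e2, e3]
  linarith

include hxs hκ1

theorem initialBound_nonneg : 0 ≤ initialBound f q S L ϑ δ κ α β τ η v₀ X₀ xs := by
  refine le_trans ?_ (le_initialBound hn hL hϑ hϑ1 hadm rfl)
  have hβ1 : 0 ≤ 1 - β := by linarith [hadm.beta_le₂]
  have hτ1 : 0 ≤ 1 - τ := by linarith [hadm.tau_lt_one]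
  have hη := hadm.eta_pos
  have hφ := sub_nonneg.2 (hxs (rowMean X₀))
  have hT : 0 ≤ trackingWeight (2 * δ ^ 2 * κ ^ 2 * L / n) ϑ :=
    le_trans (by positivity) (le_trackingWeight (by positivity) hϑ hϑ1)
  positivity

include hp hC hμ hf hfμ hv₀ hv₀n hq hS hκ

theorem outputGap_le (K : ℕ) : outputGap C f α β τ η v₀ X₀ xs K ≤
    (1 - β) ^ ((K : ℤ) - 2) * (7 / 12) * initialBound f q S L ϑ δ κ α β τ η v₀ X₀ xs := by
  obtain ⟨l, hl⟩ : ∃ l, l = 2 * δ ^ 2 * κ ^ 2 * L / n := ⟨_, rfl⟩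
  have hl0 : 0 ≤ l := by rw [hl]; positivity
  have hβ16 : β ≤ 1 / 16 := by linarith [hadm.beta_le₂]
  have hβ0 := hadm.beta_pos
  have hβ1 : 0 < 1 - β := by linarith
  have hτ := hadm.tau_pos
  have hτ1 : 0 < 1 - τ := by linarith [hadm.tau_lt_one]
  have hη := hadm.eta_pos
  have hφ := sub_nonneg.2 (hxs (rowMean X₀))
  have hstep := hadm.stepConditions hn hL hϑ hϑ1 hS.one_le hκ1 hl
  have hT : 0 ≤ trackingWeight l ϑ := le_trans (by positivity) (le_trackingWeight hl0 hϑ hϑ1)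
  have hb := le_initialBound (S := S) (q := q) (f := f) (xs := xs) (v₀ := v₀) (X₀ := X₀)
    hn hL hϑ hϑ1 hadm hl
  have hb0 := initialBound_nonneg (S := S) (q := q) (v₀ := v₀) (X₀ := X₀) hn hL hxs hϑ hϑ1 hκ1 hadm
  set b := initialBound f q S L ϑ δ κ α β τ η v₀ X₀ xs
  set φ := objective f (rowMean X₀) - objective f xs
  set A := matNorm S (consensusError q X₀) ^ 2
  set T := trackingWeight l ϑ
    * (η ^ 2 * matNorm S (consensusError q (stackedGradient f v₀ X₀)) ^ 2)
  have hT0 : 0 ≤ T := by positivity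
  have hA0 : 0 ≤ l / ϑ * A := by positivity
  have hP0 : 0 ≤ vecNorm S (v₀ - q) ^ 2 * (l / ϑ * ‖rowMean X₀‖ ^ 2) := by positivity
  have hφ0 : 0 ≤ (1 - τ) * φ := by positivity
  set ζ := 72 * τ ^ 2 / η * ‖rowMean X₀ - xs‖ ^ 2 with hζ
  have hζ0 : 0 ≤ ζ := by positivity
  have hmul : 15 / 16 * (18 * (1 - τ) * φ + ζ) ≤ (1 - β) * (18 * (1 - τ) * φ + ζ) := by
    gcongr
    linarith
  -- The integer exponent may be negative; with base in `(0, 1)`, lowering it only weakens the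
  -- bound.
  have hpow : (1 - β) ^ K ≤ (1 - β) ^ ((K : ℤ) - 2) := by
    rw [← zpow_natCast]
    exact zpow_le_zpow_right_of_le_one₀ hβ1 (by linarith) (by lia)
  cases K with
  | zero =>
    have h1 := mean_gap_le hn hL hf hxs (fun i => (weights C v₀ 0 i)⁻¹ • X₀ i) (rowMean X₀)
    have h2 := mul_dispersion_le hn hC hL hv₀ hv₀n hq hϑ1 hS hκ hl 0 X₀
    have h3 : outputGap C f α β τ η v₀ X₀ xs 0 ≤ 7 / 12 * b := by
      refine h1.trans ?_
      have h4 := (isConvexSmooth_objective hn hf).gap_le hL hxs (rowMean X₀)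
      -- For `K = 0` no step has been made, and `(1 - τ) φ` alone cannot bound `φ` when `τ` is near
      -- one. Smoothness provides a second bound through the distance term.
      have h5 : 288 * τ ^ 2 * φ ≤ ζ := by
        have hLη : L ≤ 1 / (2 * η) := by
          rw [le_div_iff₀ (by positivity)]
          linarith [hstep.smooth]
        calc 288 * τ ^ 2 * φ ≤ 288 * τ ^ 2 * (L / 2 * ‖rowMean X₀ - xs‖ ^ 2) := by gcongr
          _ ≤ 288 * τ ^ 2 * (1 / (2 * η) / 2 * ‖rowMean X₀ - xs‖ ^ 2) := by gcongr
          _ = ζ := by rw [hζ]; field_simp; ring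
      -- Together the two bounds carry the factor `18 (1 - τ + 16 τ²)`, whose minimum is at `τ =
      -- 1/32`.
      have h6 : 0 ≤ (τ - 1 / 32) ^ 2 * φ := by positivity
      have h7 : l * A ≤ l / ϑ * A := by
        gcongr; exact le_div_self hl0 hϑ hϑ1.le
      have h8 : vecNorm S (v₀ - q) ^ 2 * (l * ‖rowMean X₀‖ ^ 2)
          ≤ vecNorm S (v₀ - q) ^ 2 * (l / ϑ * ‖rowMean X₀‖ ^ 2) := by
        gcongr; exact le_div_self hl0 hϑ hϑ1.le
      rw [mul_zero, pow_zero, one_mul] at h2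
      have e1 : 480 * l / ϑ * A = 480 * (l / ϑ * A) := by ring
      have e2 : 90 * l / ϑ * ‖rowMean X₀‖ ^ 2 = 90 * (l / ϑ * ‖rowMean X₀‖ ^ 2) := by ring
      rw [e1, e2] at hb
      linarith
    refine h3.trans ?_
    rw [mul_assoc]
    exact le_mul_of_one_le_left (by positivity) (by simpa using hpow)
  | succ k =>
    have h1 := outputGap_succ_le_pow (X₀ := X₀)
      hn hp hC hL hμ hf hfμ hv₀ hv₀n hq hϑ hϑ1 hS hκ hl hstep hxs k
    have hpow2 : (1 - β) ^ k ≤ (1 - β) ^ (((k + 1 : ℕ) : ℤ) - 2) := by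
      rw [← zpow_natCast]
      exact zpow_le_zpow_right_of_le_one₀ hβ1 (by linarith) (by push_cast; lia)
    have h2 : 1 / 4 * (12 * (1 - τ) * φ + ζ + 24 * l / ϑ * A + T
        + vecNorm S (v₀ - q) ^ 2 * (24 * l / ϑ * ‖rowMean X₀‖ ^ 2)) ≤ 7 / 12 * b := by
      have e1 : ∀ c x : ℝ, c * l / ϑ * x = c * (l / ϑ * x) := fun c x => by ring
      rw [e1, e1]
      rw [e1, e1] at hb
      linarith
    refine h1.trans ?_
    calc _ = (1 - β) ^ k * (1 / 4 * (12 * (1 - τ) * φ + ζ + 24 * l / ϑ * A + T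
        + vecNorm S (v₀ - q) ^ 2 * (24 * l / ϑ * ‖rowMean X₀‖ ^ 2))) := by ring
      _ ≤ (1 - β) ^ k * (7 / 12 * b) := by gcongr
      _ ≤ (1 - β) ^ (((k + 1 : ℕ) : ℤ) - 2) * (7 / 12 * b) := by gcongr
      _ = _ := by ring

theorem outputGap_isBigO :
    (fun K : ℕ => outputGap C f α β τ η v₀ X₀ xs K) =O[Filter.atTop] fun K : ℕ => (1 - β) ^ K := by
  have hβ1 : 0 < 1 - β := by linarith [hadm.beta_le₂]
  refine Asymptotics.IsBigO.of_bound
    ((1 - β) ^ (-2 : ℤ) * (7 / 12) * initialBound f q S L ϑ δ κ α β τ η v₀ X₀ xs)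
    (Filter.Eventually.of_forall fun K => ?_)
  rw [Real.norm_of_nonneg (outputGap_nonneg hn hxs K), Real.norm_of_nonneg (by positivity)]
  refine (outputGap_le hn hp hC hL hμ hf hfμ hxs hv₀ hv₀n hq hϑ hϑ1 hS hκ1 hκ hadm K).trans_eq ?_
  rw [sub_eq_add_neg (K : ℤ), zpow_add₀ hβ1.ne', zpow_natCast]
  ring

end Bound

/-! ### The choice of parameters that gives the linear rate. -/

section LinearRate

variable {L μ ϑ δ κ w c : ℝ} {n : ℕ}

theorem le_networkFactor (hϑ : 0 < ϑ) (hδ : 1 ≤ δ) (hκ : 1 ≤ κ) :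
    δ * κ ≤ networkFactor ϑ δ κ w := by
  unfold networkFactor
  have : 0 ≤ δ * κ * w ^ 2 / ϑ := by positivity
  exact le_mul_of_one_le_right (by positivity) (by linarith)

theorem one_le_networkFactor (hϑ : 0 < ϑ) (hδ : 1 ≤ δ) (hκ : 1 ≤ κ) :
    1 ≤ networkFactor ϑ δ κ w :=
  (one_le_mul_of_one_le_of_one_le hδ hκ).trans (le_networkFactor hϑ hδ hκ)

theorem etaChoice_mul (hL : 0 < L) (hϑ : 0 < ϑ) (hδ : 1 ≤ δ) (hκ : 1 ≤ κ) :
    etaChoice c L ϑ δ κ w * (L * networkFactor ϑ δ κ w) = c * ϑ ^ 3 := by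
  have := one_le_networkFactor (w := w) hϑ hδ hκ
  unfold etaChoice
  field_simp

/-- The form in which the second, fourth and fifth bounds on the stepsize are verified. -/
theorem le_div_sqrt_bound {η b x D s : ℝ} (hb : 0 < b) (hD : 0 < D) (hs : 0 ≤ s) (hx : 0 ≤ x)
    (hbs : 64 * b ≤ (40000 * s) ^ 2) (h : 40000 * (η * D) ≤ x) :
    η ≤ s * x / (8 * Real.sqrt b * D) := by
  have hsb : 0 < Real.sqrt b := Real.sqrt_pos.2 hb
  have h1 : 8 * Real.sqrt b ≤ 40000 * s := by
    have h2 : Real.sqrt (64 * b) ≤ 40000 * s := by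
      rw [← Real.sqrt_sq (by positivity : 0 ≤ 40000 * s)]
      exact Real.sqrt_le_sqrt hbs
    rw [Real.sqrt_mul (by norm_num), show (64 : ℝ) = 8 ^ 2 by norm_num,
      Real.sqrt_sq (by norm_num)] at h2
    exact h2
  rw [le_div_iff₀ (by positivity)]
  by_cases hη : η ≤ 0
  · exact (mul_nonpos_of_nonpos_of_nonneg hη (by positivity)).trans (by positivity)
  · push Not at hη
    calc η * (8 * Real.sqrt b * D) ≤ η * (40000 * s * D) := by gcongr
      _ = s * (40000 * (η * D)) := by ring
      _ ≤ s * x := by gcongr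

theorem rateConst_mul_sqrt (hL : 0 < L) (hϑ : 0 < ϑ) (hδ : 1 ≤ δ) (hκ : 1 ≤ κ) (hc : 0 < c)
    (hμ : 0 < μ) : rateConst c ϑ δ κ w * Real.sqrt (μ / L)
      = Real.sqrt (μ * etaChoice c L ϑ δ κ w) / 24 := by
  have hN : 0 < networkFactor ϑ δ κ w :=
    zero_lt_one.trans_le (one_le_networkFactor (w := w) hϑ hδ hκ)
  have e1 : ϑ ^ (3 / 2 : ℝ) = Real.sqrt (ϑ ^ 3) := by
    rw [Real.sqrt_eq_rpow, ← Real.rpow_natCast, ← Real.rpow_mul hϑ.le]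
    norm_num
  have e2 : networkFactor ϑ δ κ w ^ (-(1 / 2) : ℝ) = Real.sqrt (networkFactor ϑ δ κ w)⁻¹ := by
    rw [Real.rpow_neg hN.le, ← Real.sqrt_eq_rpow, Real.sqrt_inv]
  unfold rateConst etaChoice
  rw [e1, e2]
  have e3 : μ * (c * ϑ ^ 3 / (L * networkFactor ϑ δ κ w))
      = c * ϑ ^ 3 * (networkFactor ϑ δ κ w)⁻¹ * (μ / L) := by field_simp
  rw [e3, Real.sqrt_mul (by positivity), Real.sqrt_mul (by positivity),
    Real.sqrt_mul (by positivity)]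
  ring

theorem admissible_etaChoice (hn : 0 < n) (hL : 0 < L) (hμ : 0 < μ) (hμL : μ ≤ L) (hϑ : 0 < ϑ)
    (hϑ1 : ϑ < 1) (hδ : 1 ≤ δ) (hκ : 1 ≤ κ) (hc : 0 < c) (hc1 : c ≤ 1 / 40000)
    {α β τ η : ℝ} (hη : η = etaChoice c L ϑ δ κ w) (hτ : τ = Real.sqrt (μ * η))
    (hα : α = 1 / (12 * Real.sqrt (μ * η))) (hβ : β = Real.sqrt (μ * η) / 24) :
    Admissible n L μ ϑ δ κ w α β τ η := by
  have hN1 := one_le_networkFactor (w := w) hϑ hδ hκ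
  have hN2 := le_networkFactor (w := w) hϑ hδ hκ
  have hη0 : 0 < η := by
    rw [hη]; unfold etaChoice; positivity
  have hmul : η * (L * networkFactor ϑ δ κ w) = c * ϑ ^ 3 := by
    rw [hη]; exact etaChoice_mul hL hϑ hδ hκ
  have hmul' : 40000 * (η * (L * networkFactor ϑ δ κ w)) ≤ ϑ ^ 3 := by
    rw [hmul]
    have : c * ϑ ^ 3 ≤ 1 / 40000 * ϑ ^ 3 := by gcongr
    linarith
  have hηδ : 40000 * (η * (δ * κ * L)) ≤ ϑ ^ 3 := by
    refine le_trans ?_ hmul'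
    rw [mul_comm (δ * κ) L]
    gcongr
  have hηL : 40000 * (η * L) ≤ ϑ ^ 3 := by
    refine le_trans ?_ hηδ
    have : 1 ≤ δ * κ := one_le_mul_of_one_le_of_one_le hδ hκ
    gcongr
    exact le_mul_of_one_le_left hL.le this
  have hϑ3 : ϑ ^ 3 ≤ 1 := pow_le_one₀ hϑ.le hϑ1.le
  have hϑ32 : ϑ ^ 3 ≤ ϑ ^ 2 := pow_le_pow_of_le_one hϑ.le hϑ1.le (by norm_num)
  rw [← hτ] at hα hβ
  have hτ0 : 0 < τ := by rw [hτ]; positivity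
  have hτ2 : τ ^ 2 = μ * η := by rw [hτ, Real.sq_sqrt (by positivity)]
  have hτϑ : 40000 * τ ^ 2 ≤ ϑ ^ 3 := by
    rw [hτ2]
    have : μ * η ≤ L * η := by gcongr
    linarith
  -- Here `40000 = 200 ^ 2`, and `ϑ ^ 3 ≤ ϑ ^ 2`.
  have hτ200 : 200 * τ ≤ ϑ := by
    have : (200 * τ) ^ 2 ≤ ϑ ^ 2 := by linarith
    exact (pow_le_pow_iff_left₀ (by positivity) hϑ.le two_ne_zero).1 this
  have hατ : α * τ = 1 / 12 := by rw [hα]; field_simp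
  refine ⟨hατ, hτ0, by linarith, hη0, ?_, ?_, ?_, ?_, ?_, by rw [hβ]; positivity, by linarith,
    by linarith, ?_, ?_⟩
  · rw [hατ]
    -- The second summand of the network factor is there for this bound.
    have h1 : η * (δ ^ 2 * κ ^ 2 * w ^ 2 * L) ≤ ϑ * (η * (L * networkFactor ϑ δ κ w)) := by
      have h2 : η * (δ ^ 2 * κ ^ 2 * w ^ 2 * L) = η * L * (δ * κ * (δ * κ * w ^ 2)) := by ring
      have h3 : ϑ * (η * (L * networkFactor ϑ δ κ w))
          = η * L * (δ * κ * (ϑ + δ * κ * w ^ 2)) := by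
        unfold networkFactor; field_simp
      rw [h2, h3]
      gcongr
      linarith
    have h2 : ϑ * (40000 * (η * (L * networkFactor ϑ δ κ w))) ≤ ϑ * ϑ ^ 3 := by gcongr
    have h3 : ϑ ^ 4 ≤ n * ϑ ^ 4 := by
      have : (1 : ℝ) ≤ n := by exact_mod_cast hn
      exact le_mul_of_one_le_left (by positivity) this
    have h4 : 0 ≤ η * (δ ^ 2 * κ ^ 2 * w ^ 2 * L) := by positivity
    have h5 : ϑ * ϑ ^ 3 = ϑ ^ 4 := by ring
    linarith
  · rw [hατ, piThree_eq, mul_assoc (8 * _) δ, mul_assoc (8 * _) (δ * κ)]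
    refine le_div_sqrt_bound (by positivity) (by positivity) (by positivity) (by positivity) ?_ hηδ
    rw [mul_pow, Real.sq_sqrt (by norm_num)]
    linarith
  · rw [hατ, le_div_iff₀ (by positivity)]
    linarith
  · rw [hατ, piThree_eq, mul_assoc (8 * _) δ, mul_assoc (8 * _) (δ * κ), ← one_mul (ϑ ^ 3)]
    refine le_div_sqrt_bound (by positivity) (by positivity) (by positivity) (by positivity) ?_ hηδ
    linarith
  · rw [hατ, piThree_eq, mul_assoc (8 * _) δ, mul_assoc (8 * _) (δ * κ), ← one_mul (ϑ ^ 3)]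
    refine le_div_sqrt_bound (by positivity) (by positivity) (by positivity) (by positivity) ?_ hηδ
    linarith
  · rw [le_div_iff₀ (by positivity), hβ]
    have : τ / 24 * (8 * τ) = 1 / 3 * τ ^ 2 := by ring
    linarith [sq_nonneg τ]
  · have h1 : μ * α * η / 2 = α * τ * τ / 2 := by
      calc μ * α * η / 2 = α * (μ * η) / 2 := by ring
        _ = α * τ * τ / 2 := by rw [← hτ2]; ring
    rw [h1, hατ, hβ]
    linarith

end LinearRate

end PushDIGing

end

open PushDIGing in
theorem mainTheorem2 {n p : ℕ} (hn : 0 < n) (hp : 0 < p)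
    -- the network and its mixing matrix
    (𝒢 : Digraph (Fin n)) (h𝒢 : StronglyConnected 𝒢)
    (C : Matrix (Fin n) (Fin n) ℝ) (hC : IsMixingMatrix 𝒢 C)
    -- the objective functions and the minimizer
    (L μ : ℝ) (hL : 0 < L) (hμ : 0 < μ) (f : Fin n → Vec p → ℝ)
    (hf : ∀ i, IsConvexSmooth L (f i)) (hfμ : ∀ i, IsStronglyConvex μ (f i))
    (xs : Vec p) (hxs : ∀ x, objective f xs ≤ objective f x)
    -- the initial values
    (X₀ : Stack n p) (v₀ : Fin n → ℝ) (hv₀ : ∀ i, 0 < v₀ i) (hv₀n : ∑ i, v₀ i = n) :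
    -- the quantities in the bound are well defined:
    -- the Perron vector, the bound on the inverse weights, the spectral gap, the mixing norms
    (∃! q : Fin n → ℝ, IsPerronVector C q) ∧
    (1 ≤ kappa C v₀ ∧ ∀ k i, (weights C v₀ k i)⁻¹ ≤ kappa C v₀) ∧
    ∀ q : Fin n → ℝ, IsPerronVector C q →
      rho (C - rankOne q) < 1 ∧
      ∀ ϑ : ℝ, 0 < ϑ → ϑ < 1 - rho (C - rankOne q) →
        (∃ S δ, IsMixingNorm C q ϑ S δ) ∧
        ∀ (S : Matrix (Fin n) (Fin n) ℝ) (δ : ℝ), IsMixingNorm C q ϑ S δ →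
          -- the bound for every admissible choice of the parameters
          (∀ α β τ η : ℝ,
            Admissible n L μ ϑ δ (kappa C v₀) (vecNorm S (v₀ - q)) α β τ η →
            (∀ K : ℕ,
              outputGap C f α β τ η v₀ X₀ xs K ≤
                (1 - β) ^ ((K : ℤ) - 2) *
                (7 / 12 + 3 * δ ^ 2 * kappa C v₀ ^ 2 * (1 - ϑ) ^ (2 * K)
                    * vecNorm S (v₀ - q) ^ 2 * η * L / n) *
                (18 * (1 - β) * (1 - τ) * (objective f (rowMean X₀) - objective f xs)
                  + 960 * δ ^ 2 * kappa C v₀ ^ 2 * L / (n * ϑ)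
                    * phiFour q S ϑ (α * τ) η X₀ (stackedGradient f v₀ X₀)
                  + 180 * δ ^ 2 * kappa C v₀ ^ 2 * L * vecNorm S (v₀ - q) ^ 2 / (n * ϑ)
                    * phiThree ϑ τ X₀
                  + (1 - β) / (2 * α ^ 2 * η) * ‖rowMean X₀ - xs‖ ^ 2)) ∧
            phiThree ϑ τ X₀ ≤ (1 + 8 / ϑ ^ 2) * ∑ i, ‖X₀ i‖ ^ 2) ∧
          -- the linear rate for the advertised choice of the parameters
          (∀ c η τ α β : ℝ, 0 < c → c ≤ 1 / 40000 →
            η = etaChoice c L ϑ δ (kappa C v₀) (vecNorm S (v₀ - q)) →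
            τ = Real.sqrt (μ * η) → α = 1 / (12 * Real.sqrt (μ * η)) →
            β = Real.sqrt (μ * η) / 24 →
            Admissible n L μ ϑ δ (kappa C v₀) (vecNorm S (v₀ - q)) α β τ η ∧
            0 < rateConst c ϑ δ (kappa C v₀) (vecNorm S (v₀ - q)) * Real.sqrt (μ / L) ∧
            rateConst c ϑ δ (kappa C v₀) (vecNorm S (v₀ - q)) * Real.sqrt (μ / L) < 1 ∧
            (fun K : ℕ => outputGap C f α β τ η v₀ X₀ xs K) =O[Filter.atTop]
              fun K : ℕ =>
                (1 - rateConst c ϑ δ (kappa C v₀) (vecNorm S (v₀ - q))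
                  * Real.sqrt (μ / L)) ^ K) := by
  refine ⟨?_, one_le_kappa hn hC hv₀ hv₀n, fun q hq => ⟨rho_lt_one hn hC hq, fun ϑ hϑ hϑρ =>
    ⟨exists_isMixingNorm hn hC hq hϑρ, fun S δ hS => ?_⟩⟩⟩
  · obtain ⟨q, hq⟩ := exists_isPerronVector hn hC
    exact ⟨q, hq, fun q' hq' => hq'.unique hn hC hq⟩
  obtain ⟨hκ1, hκ⟩ := one_le_kappa hn hC hv₀ hv₀n
  have hϑ1 : ϑ < 1 := by
    have : 0 ≤ rho (C - rankOne q) := ENNReal.toReal_nonneg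
    linarith
  have hμL : μ ≤ L := (hfμ ⟨0, hn⟩).le_smoothness (hf ⟨0, hn⟩) hL hp
  refine ⟨fun α β τ η hadm => ⟨fun K => ?_, phiThree_le hn hϑ hadm.tau_pos hadm.tau_lt_one X₀⟩,
    fun c η τ α β hc hc1 hη hτ hα hβ => ?_⟩
  · refine (outputGap_le hn hp hC hL hμ hf hfμ hxs hv₀ hv₀n hq hϑ hϑ1 hS hκ1 hκ hadm K).trans ?_
    have hb := initialBound_nonneg (S := S) (q := q) (X₀ := X₀) hn hL hxs hϑ hϑ1 hκ1 hadm
    have hβ1 : 0 < 1 - β := by linarith [hadm.beta_le₂]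
    have hϑ0 : 0 ≤ 1 - ϑ := by linarith
    have hη := hadm.eta_pos
    refine mul_le_mul_of_nonneg_right (mul_le_mul_of_nonneg_left ?_ (by positivity)) hb
    -- The factor `7/12` alone already suffices; the remaining summand is nonnegative.
    exact le_add_of_nonneg_right (by positivity)
  · have hadm : Admissible n L μ ϑ δ (kappa C v₀) (vecNorm S (v₀ - q)) α β τ η :=
      admissible_etaChoice hn hL hμ hμL hϑ hϑ1 hS.one_le hκ1 hc hc1 hη hτ hα hβ
    have hrate : rateConst c ϑ δ (kappa C v₀) (vecNorm S (v₀ - q)) * Real.sqrt (μ / L) = β := by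
      rw [hβ, hη]
      exact rateConst_mul_sqrt hL hϑ hS.one_le hκ1 hc hμ
    rw [hrate]
    exact ⟨hadm, hadm.beta_pos, by linarith [hadm.beta_le₂],
      outputGap_isBigO hn hp hC hL hμ hf hfμ hxs hv₀ hv₀n hq hϑ hϑ1 hS hκ1 hκ hadm⟩
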